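/- Let $m\ge 1$ and let $(X_{n,i})_{1\le i\le n,\ n\ge 1}$ be a triangular array of random vectors in $\mathbb{R}^m$ on a measurable space; write $X_i$ for $X_{n,i}$. A DGP is a probability measure $\mathbf P$ on this space under which, for each $n$, $X_1,\dots,X_n$ are identically distributed (possibly dependent) and integrable; put $\mu_0(\mathbf P)=\mathbf E_{\mathbf P}[X_1]$ (which may depend on $n$). Let $\bar X=n^{-1}\sum_{i=1}^n X_i$ and $\hat\Sigma=n^{-1}\sum_{i=1}^n (X_i-\bar X)(X_i-\bar X)'$. Let $R_n$ be positive integers and, independently of the data, let $\pi=(\pi_r)_{r=1}^{R_n}$ be i.i.d. uniform random permutations of $\{1,\dots,n\}$. For $1\le k\le m$ and $\mu\in\mathbb R$ let $$T_{U,k}(\mu;\pi)=\frac1{\sqrt{mR_n}}\sum_{r=1}^{R_n}(X_{\pi_r(1),k}-\mu)\,\hat\Sigma_{kk}^{-1}\,(X_{\pi_r(2),k}-\mu),$$ $$\hat\lambda_k=\bar X_k\hat\Sigma_{kk}^{-1}\frac1{\sqrt{mR_n}}\sum_{r=1}^{R_n}(X_{\pi_r(1),k}+X_{\pi_r(2),k})-\sqrt{\frac{R_n}{m}}\,\hat\Sigma_{kk}^{-1}\bar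 X_k^2,$$ $$Q_n(\pi)=\max_{1\le k\le m}\{T_{U,k}(0;\pi)-\hat\lambda_k\mathbf 1\{\bar X_k<0\}\},\qquad \tilde Q_n(\pi)=\max_{1\le k\le m}T_{U,k}(\bar X_k;\pi).$$ For $\alpha\in(0,1)$ let $c_{1-\alpha}$ be the $(1-\alpha)$-quantile of the distribution of $\tilde Q_n(\pi)$ conditional on the data, and let $\phi_n=\mathbf 1\{Q_n(\pi)>c_{1-\alpha}\}$. Let $\mathcal P_0$ be a nonempty set of DGPs for which there are $\delta,L,U\in(0,\infty)$ such that every sequence $\{\mathbf P_n\}\subseteq\mathcal P_0$ satisfies, as $n\to\infty$ with the sample of size $n$ drawn from $\mathbf P_n$: (a) $n^{-1/2}\sum_{i=1}^n (X_i-\mu_0(\mathbf P_n))=O_{\mathbf P_n}(1)$; (b) there are symmetric matrices $\Sigma_n$ (for instance, a fixed matrix $\Sigma_n=\Sigma$) with $\max_{i,j}|(\Sigma_n)_{ij}|<U$ and $\lambda_{\min}(\Sigma_n)>L$ for all $n$, such that $\hat\Sigma-\Sigma_n\to 0$ in $\mathbf P_n$-probability; (c) $n^{-1}\sum_{i=1}^n\|X_i\|^{2+\delta}=O_{\mathbf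 P_n}(1)$, where $\|\cdot\|$ is the sup norm; (d) $\mu_0(\mathbf P_n)\le 0$ componentwise for all $n$. If $R_n\to\infty$ and $\sqrt{R_n}/n\to 0$, then $$\sup_{\mathbf P\in\mathcal P_0}\mathbf E_{\mathbf P}[\phi_n]\longrightarrow\alpha .$$ -/

import Mathlib

open MeasureTheory ProbabilityTheory Filter Topology

namespace ResampledMI

noncomputable section

/-! ### Statistics of a data set

A data set of size `n` is `x : Fin n → Fin m → ℝ`; the norm on `Fin m → ℝ` is the sup norm. -/

/-- The observation in (zero-based) position `j`; the value `0` is used only when `j ≥ n`. -/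
def obs {n m : ℕ} (x : Fin n → Fin m → ℝ) (j : ℕ) : Fin m → ℝ :=
  if h : j < n then x ⟨j, h⟩ else 0

/-- The observation `X_{σ(j+1)}`: the one that the permutation `σ` puts in position `j`. -/
def draw {n m : ℕ} (x : Fin n → Fin m → ℝ) (σ : Equiv.Perm (Fin n)) (j : ℕ) : Fin m → ℝ :=
  obs (fun i => x (σ i)) j

/-- The sample mean. -/
def sampleMean {n m : ℕ} (x : Fin n → Fin m → ℝ) : Fin m → ℝ :=
  (n : ℝ)⁻¹ • ∑ i, x i

/-- The sample variance matrix `n⁻¹ ∑ᵢ (Xᵢ - X̄)(Xᵢ - X̄)'`. -/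
def sampleVar {n m : ℕ} (x : Fin n → Fin m → ℝ) : Matrix (Fin m) (Fin m) ℝ :=
  (n : ℝ)⁻¹ • ∑ i, Matrix.vecMulVec (x i - sampleMean x) (x i - sampleMean x)

/-- The U-type statistic of the `k`-th coordinate, centred at `μ`, from `R` permutations. -/
def uStat {n m R : ℕ} (x : Fin n → Fin m → ℝ) (k : Fin m) (μ : ℝ)
    (π : Fin R → Equiv.Perm (Fin n)) : ℝ :=
  1 / √((m : ℝ) * R) *
    ∑ r, (draw x (π r) 0 k - μ) * (sampleVar x k k)⁻¹ * (draw x (π r) 1 k - μ)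

/-- The correction term `λ̂ₖ`. -/
def lambdaHat {n m R : ℕ} (x : Fin n → Fin m → ℝ) (k : Fin m)
    (π : Fin R → Equiv.Perm (Fin n)) : ℝ :=
  sampleMean x k * (sampleVar x k k)⁻¹ * (1 / √((m : ℝ) * R)) *
      ∑ r, (draw x (π r) 0 k + draw x (π r) 1 k)
    - √((R : ℝ) / m) * (sampleVar x k k)⁻¹ * sampleMean x k ^ 2

/-- The test statistic `Qₙ(π)`. -/
def qStat {n m R : ℕ} (x : Fin n → Fin m → ℝ) (π : Fin R → Equiv.Perm (Fin n)) : ℝ :=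
  ⨆ k : Fin m, (uStat x k 0 π - if sampleMean x k < 0 then lambdaHat x k π else 0)

/-- The resampling statistic `Q̃ₙ(π)`. -/
def qTilde {n m R : ℕ} (x : Fin n → Fin m → ℝ) (π : Fin R → Equiv.Perm (Fin n)) : ℝ :=
  ⨆ k : Fin m, uStat x k (sampleMean x k) π

/-! ### The random permutations, the critical value and the test -/

instance permMeasurableSpace (n : ℕ) : MeasurableSpace (Equiv.Perm (Fin n)) := ⊤

instance permDiscrete (n : ℕ) : DiscreteMeasurableSpace (Equiv.Perm (Fin n)) :=
  ⟨fun _ => trivial⟩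

/-- The law of `R` i.i.d. uniform permutations of `n` indices. -/
def drawLaw (n R : ℕ) : Measure (Fin R → Equiv.Perm (Fin n)) :=
  Measure.pi fun _ => uniformOn Set.univ

/-- The `(1 - α)`-quantile of the law of `Q̃ₙ(π)` when the data are held fixed at `x`. -/
def critVal {n m : ℕ} (R : ℕ) (α : ℝ) (x : Fin n → Fin m → ℝ) : ℝ :=
  sInf {c : ℝ | 1 - α ≤ (drawLaw n R).real {π | qTilde x π ≤ c}}

/-- The test `φₙ = 1{Qₙ(π) > c_{1-α}}`. -/
def testFn {n m R : ℕ} (α : ℝ) (x : Fin n → Fin m → ℝ)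
    (π : Fin R → Equiv.Perm (Fin n)) : ℝ :=
  if critVal R α x < qStat x π then 1 else 0

/-! ### Data-generating processes

The data form a triangular array: the sample of size `n` is `X n 0, …, X n (n-1)`. A
data-generating process is a probability measure on the underlying space `Ω`. -/

variable {Ω : Type*} [MeasurableSpace Ω] {m : ℕ}

/-- The sample of size `n` at the outcome `ω`. -/
def sample (X : (n : ℕ) → Fin n → Ω → Fin m → ℝ) (n : ℕ) (ω : Ω) : Fin n → Fin m → ℝ :=
  fun i => X n i ω

/-- The rejection probability `E_P[φₙ]`; the permutations are independent of the data. -/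
def rejProb (X : (n : ℕ) → Fin n → Ω → Fin m → ℝ) (α : ℝ) (n R : ℕ)
    (P : ProbabilityMeasure Ω) : ℝ :=
  ∫ z : Ω × (Fin R → Equiv.Perm (Fin n)), testFn α (sample X n z.1) z.2
    ∂((P : Measure Ω).prod (drawLaw n R))

/-- `μ₀(P) = E_P[X₁]`, for the sample of size `n`. -/
def mean (X : (n : ℕ) → Fin n → Ω → Fin m → ℝ) (n : ℕ) (P : ProbabilityMeasure Ω) :
    Fin m → ℝ :=
  ∫ ω, obs (sample X n ω) 0 ∂(P : Measure Ω)

/-- Under `P`, every row of the array consists of identically distributed integrable vectors. -/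
def RowsIdentDistrib (X : (n : ℕ) → Fin n → Ω → Fin m → ℝ) (P : ProbabilityMeasure Ω) : Prop :=
  ∀ n, ∀ i j : Fin n, Integrable (X n i) (P : Measure Ω) ∧
    IdentDistrib (X n i) (X n j) (P : Measure Ω) (P : Measure Ω)

/-- `Yₙ = O_{Pₙ}(1)`. -/
def IsBoundedInProb {E : Type*} [Norm E] (P : ℕ → ProbabilityMeasure Ω) (Y : ℕ → Ω → E) :
    Prop :=
  ∀ ε > (0 : ℝ), ∃ M : ℝ, ∀ᶠ n in atTop, (P n : Measure Ω).real {ω | M < ‖Y n ω‖} ≤ ε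

/-- `‖M‖ = max_{i,j} |M i j|`. -/
def maxNorm (M : Matrix (Fin m) (Fin m) ℝ) : ℝ :=
  ⨆ i, ⨆ j, |M i j|

/-- `P₀` is a class of null data-generating processes: with constants `δ, L, U ∈ (0, ∞)` common to
the class, along every sequence in `P₀` the sample mean is `√n`-consistent, the sample variance is
consistent for variance matrices `S n` bounded by `U` with smallest eigenvalue above `L`, the
empirical moments of order `2 + δ` are bounded in probability, and the means are nonpositive. -/
def IsNullClass (X : (n : ℕ) → Fin n → Ω → Fin m → ℝ) (P₀ : Set (ProbabilityMeasure Ω)) : Prop :=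
  (∀ P ∈ P₀, RowsIdentDistrib X P) ∧
  ∃ δ L U : ℝ, 0 < δ ∧ 0 < L ∧ 0 < U ∧
    ∀ P : ℕ → ProbabilityMeasure Ω, (∀ n, P n ∈ P₀) →
      IsBoundedInProb P (fun n ω => (√(n : ℝ))⁻¹ • ∑ i, (X n i ω - mean X n (P n))) ∧
      (∃ S : ℕ → Matrix (Fin m) (Fin m) ℝ,
        (∀ n, maxNorm (S n) < U ∧ ∃ h : (S n).IsHermitian, ∀ k, L < h.eigenvalues k) ∧
        ∀ ε > (0 : ℝ), Tendsto
          (fun n => (P n : Measure Ω).real {ω | ε ≤ maxNorm (sampleVar (sample X n ω) - S n)})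
          atTop (𝓝 0)) ∧
      IsBoundedInProb P (fun n ω => (n : ℝ)⁻¹ * ∑ i, ‖X n i ω‖ ^ (2 + δ)) ∧
      (∀ n, mean X n (P n) ≤ 0)

end

end ResampledMI

/-!
No central limit theorem is needed. Given the data, `Q̃ₙ` is a maximum over the coordinates of
sums of `Rₙ` independent terms, and centring the U-type statistic at `X̄ₖ` is the same as
subtracting `λ̂ₖ`. Hence `Qₙ` and `Q̃ₙ` differ only through the `λ̂ₖ` of the coordinates with
`X̄ₖ ≥ 0`; for these `X̄ₖ = O_P(n^{-1/2})`, and Chebyshev's inequality gives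
`λ̂ₖ = O_P(√Rₙ / n + n^{-1/2})`. It remains to see that `Q̃ₙ` puts little mass near its own
quantile. The variance bound and the moments of order `2 + δ` force the centred data, and
therefore the kernel of the U-type statistic, to take both signs with probability bounded below.
This makes the characteristic function of a sum of many independent copies decay, so that no short
interval carries much of its mass. The conditional rejection probability is thus close to `α`
uniformly over all regular data sets, and the supremum over the class is handled by following a
worst sequence of data-generating processes.
-/

namespace ResampledMI

/-! ### Characteristic functions and anticoncentration -/

theorem integral_charFun_comm (μ ν : Measure ℝ) [IsFiniteMeasure μ] [IsFiniteMeasure ν] :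
    ∫ t, charFun μ t ∂ν = ∫ t, charFun ν t ∂μ := by
  simp_rw [charFun_apply_real]
  rw [integral_integral_swap]
  · simp_rw [mul_comm]
  · refine Integrable.of_bound (C := 1) (Continuous.aestronglyMeasurable (by fun_prop))
      (ae_of_all _ fun p => ?_)
    rw [Function.uncurry, ← Complex.ofReal_mul, Complex.norm_exp_ofReal_mul_I]

theorem integral_exp_neg_sq_div_two_le (ν : Measure ℝ) [IsFiniteMeasure ν] :
    ∫ x, Real.exp (-x ^ 2 / 2) ∂ν ≤ ∫ s, ‖charFun ν s‖ ∂(gaussianReal 0 1) :=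
  calc ∫ x, Real.exp (-x ^ 2 / 2) ∂ν
      ≤ ‖∫ x, charFun (gaussianReal 0 1) x ∂ν‖ := by
        have h (x : ℝ) : charFun (gaussianReal 0 1) x = (Real.exp (-x ^ 2 / 2) : ℂ) := by
          simp [charFun_gaussianReal, neg_div]
        simp_rw [h]
        rw [integral_complex_ofReal, Complex.norm_real]
        exact le_abs_self _
    _ = ‖∫ s, charFun ν s ∂(gaussianReal 0 1)‖ := by rw [integral_charFun_comm]
    _ ≤ ∫ s, ‖charFun ν s‖ ∂(gaussianReal 0 1) := norm_integral_le_integral_norm _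

theorem measureReal_Icc_neg_one_one_le (ν : Measure ℝ) [IsFiniteMeasure ν] :
    ν.real (Set.Icc (-1) 1) ≤ 2 * ∫ s, ‖charFun ν s‖ ∂(gaussianReal 0 1) := by
  have hexp_le_one (x : ℝ) : Real.exp (-x ^ 2 / 2) ≤ 1 :=
    Real.exp_le_one_iff.mpr (by linarith [sq_nonneg x])
  have hint : Integrable (fun x : ℝ => Real.exp (-x ^ 2 / 2)) ν :=
    Integrable.of_bound (C := 1) (Continuous.aestronglyMeasurable (by fun_prop))
      (ae_of_all _ fun x => by simpa only [Real.norm_eq_abs, Real.abs_exp] using hexp_le_one x)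
  calc ν.real (Set.Icc (-1) 1)
      = ∫ x, (Set.Icc (-1) 1).indicator 1 x ∂ν := (integral_indicator_one measurableSet_Icc).symm
    _ ≤ ∫ x, 2 * Real.exp (-x ^ 2 / 2) ∂ν := by
        refine integral_mono ((integrable_const (1 : ℝ)).indicator measurableSet_Icc)
          (hint.const_mul 2) fun x => Set.indicator_apply_le' (fun hx => ?_) fun _ => by positivity
        have hsq : x ^ 2 ≤ 1 := (sq_le_one_iff_abs_le_one x).mpr (abs_le.mpr hx)
        have := Real.add_one_le_exp (-x ^ 2 / 2)
        simp only [Pi.one_apply]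
        linarith
    _ = 2 * ∫ x, Real.exp (-x ^ 2 / 2) ∂ν := integral_const_mul _ _
    _ ≤ 2 * ∫ s, ‖charFun ν s‖ ∂(gaussianReal 0 1) := by
        gcongr
        exact integral_exp_neg_sq_div_two_le ν

theorem measureReal_closedBall_le_integral_norm_charFun (ν : Measure ℝ) [IsFiniteMeasure ν]
    (c : ℝ) {ε : ℝ} (hε : 0 < ε) :
    ν.real (Metric.closedBall c ε) ≤ 2 * ∫ s, ‖charFun ν (s / ε)‖ ∂(gaussianReal 0 1) := by
  have hball : (fun x => (x - c) / ε) ⁻¹' Set.Icc (-1) 1 = Metric.closedBall c ε := by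
    ext x
    rw [Set.mem_preimage, Set.mem_Icc, ← abs_le, abs_div, abs_of_pos hε, div_le_one hε,
      Metric.mem_closedBall, Real.dist_eq]
  have hchar (s : ℝ) : ‖charFun (ν.map fun x => (x - c) / ε) s‖ = ‖charFun ν (s / ε)‖ := by
    have hmap : ν.map (fun x => (x - c) / ε) = (ν.map (· + -c)).map (ε⁻¹ * ·) := by
      rw [Measure.map_map (by fun_prop) (by fun_prop)]
      congr 1 with x
      simp only [Function.comp_apply]
      ring
    rw [hmap, charFun_map_mul, charFun_map_add_const, norm_mul, Complex.norm_exp_ofReal_mul_I,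
      mul_one, inv_mul_eq_div]
  have h := measureReal_Icc_neg_one_one_le (ν.map fun x => (x - c) / ε)
  rw [map_measureReal_apply (by fun_prop) measurableSet_Icc, hball] at h
  simpa only [hchar] using h

theorem integrable_exp_neg_mul_sq_gaussianReal {β : ℝ} (hβ : 0 ≤ β) :
    Integrable (fun s : ℝ => Real.exp (-β * s ^ 2)) (gaussianReal 0 1) := by
  refine Integrable.of_bound (C := 1) (Continuous.aestronglyMeasurable (by fun_prop))
    (ae_of_all _ fun s => ?_)
  rw [Real.norm_eq_abs, Real.abs_exp, Real.exp_le_one_iff]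
  nlinarith [sq_nonneg s]

theorem integrable_sq_gaussianReal : Integrable (fun s : ℝ => s ^ 2) (gaussianReal 0 1) :=
  (memLp_id_gaussianReal 2).integrable_sq

theorem integral_exp_neg_mul_sq_gaussianReal_le {β : ℝ} (hβ : 0 < β) :
    ∫ s, Real.exp (-β * s ^ 2) ∂(gaussianReal 0 1) ≤ 1 / √(2 * β) := by
  have hdensity (s : ℝ) : gaussianPDFReal 0 1 s • Real.exp (-β * s ^ 2)
      = (√(2 * Real.pi))⁻¹ * Real.exp (-(β + 1 / 2) * s ^ 2) := by
    simp only [gaussianPDFReal, NNReal.coe_one, mul_one, sub_zero, smul_eq_mul]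
    rw [mul_assoc, ← Real.exp_add]
    ring_nf
  rw [integral_gaussianReal_eq_integral_smul one_ne_zero]
  simp_rw [hdensity]
  rw [integral_const_mul, integral_gaussian, ← Real.sqrt_inv, ← Real.sqrt_mul (by positivity),
    ← Real.sqrt_one, ← Real.sqrt_div' 1 (by positivity), Real.sqrt_one]
  refine Real.sqrt_le_sqrt ?_
  have hpi := Real.pi_pos
  rw [inv_mul_eq_div, div_div, div_le_div_iff₀ (by positivity) (by positivity)]
  nlinarith

theorem integral_sq_gaussianReal : ∫ s, s ^ 2 ∂(gaussianReal 0 1) = 1 := by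
  have h := variance_fun_id_gaussianReal (μ := 0) (v := 1)
  rw [variance_of_integral_eq_zero (by fun_prop) (by simp)] at h
  simpa using h

theorem norm_charFun_sq_eq_integral_cos (ν : Measure ℝ) [IsFiniteMeasure ν] (t : ℝ) :
    ‖charFun ν t‖ ^ 2 = ∫ p : ℝ × ℝ, Real.cos (t * (p.1 - p.2)) ∂(ν.prod ν) := by
  have hint : Integrable (fun p : ℝ × ℝ =>
      Complex.exp (t * p.1 * Complex.I) * Complex.exp ((-t : ℝ) * p.2 * Complex.I))
      (ν.prod ν) := by
    refine Integrable.of_bound (C := 1) (Continuous.aestronglyMeasurable (by fun_prop))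
      (ae_of_all _ fun p => ?_)
    rw [norm_mul, ← Complex.ofReal_mul, ← Complex.ofReal_mul, Complex.norm_exp_ofReal_mul_I,
      Complex.norm_exp_ofReal_mul_I, one_mul]
  have hprod : charFun ν t * charFun ν (-t) = (‖charFun ν t‖ ^ 2 : ℝ) := by
    rw [charFun_neg, Complex.mul_conj, Complex.normSq_eq_norm_sq]
  rw [← Complex.ofReal_re (‖charFun ν t‖ ^ 2), ← hprod, charFun_apply_real, charFun_apply_real,
    ← integral_prod_mul]
  refine (integral_re hint).symm.trans (integral_congr_ae (ae_of_all _ fun p => ?_))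
  have harg : (t * p.1 * Complex.I + (-t : ℝ) * p.2 * Complex.I : ℂ)
      = (t * (p.1 - p.2) : ℝ) * Complex.I := by
    push_cast
    ring
  simp only [← Complex.exp_add, harg, RCLike.re_to_complex, Complex.exp_ofReal_mul_I_re]

/-- `ν` puts mass at least `q` on `[b, B]` and on `[-B, -b]`: a quantitative form of non-degeneracy
that passes to products of variables and makes the characteristic function decay. -/
def IsTwoSided (ν : Measure ℝ) (b B q : ℝ) : Prop :=
  q ≤ ν.real (Set.Icc b B) ∧ q ≤ ν.real (Set.Icc (-B) (-b))

theorem cos_le_one_sub_sq_div_eight {u : ℝ} (hu : |u| ≤ Real.pi) :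
    Real.cos u ≤ 1 - u ^ 2 / 8 := by
  have hpi : (1 : ℝ) / 8 ≤ 2 / Real.pi ^ 2 := by
    rw [div_le_div_iff₀ (by norm_num) (by positivity)]
    nlinarith [Real.pi_lt_four, Real.pi_pos]
  have := mul_le_mul_of_nonneg_right hpi (sq_nonneg u)
  linarith [Real.cos_le_one_sub_mul_cos_sq hu]

theorem IsTwoSided.norm_charFun_sq_le {ν : Measure ℝ} [IsProbabilityMeasure ν] {b B q : ℝ}
    (hν : IsTwoSided ν b B q) (hb : 0 ≤ b) (hq : 0 ≤ q) {t : ℝ} (ht : |t| * B ≤ 1) :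
    ‖charFun ν t‖ ^ 2 ≤ 1 - q ^ 2 * (b ^ 2 / 2 * t ^ 2) := by
  set E := Set.Icc b B ×ˢ Set.Icc (-B) (-b)
  have hE : MeasurableSet E := measurableSet_Icc.prod measurableSet_Icc
  have hcos (p : ℝ × ℝ) :
      Real.cos (t * (p.1 - p.2)) ≤ 1 - E.indicator (fun _ => b ^ 2 / 2 * t ^ 2) p := by
    by_cases hp : p ∈ E
    · have ⟨⟨hb₁, hB₁⟩, ⟨hB₂, hb₂⟩⟩ := hp
      have habs : |t * (p.1 - p.2)| ≤ Real.pi := by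
        rw [abs_mul, abs_of_nonneg (by linarith : 0 ≤ p.1 - p.2)]
        have := mul_le_mul_of_nonneg_left (by linarith : p.1 - p.2 ≤ 2 * B) (abs_nonneg t)
        linarith [Real.pi_gt_three]
      have hgap : (2 * b) ^ 2 ≤ (p.1 - p.2) ^ 2 := by
        gcongr
        linarith
      rw [Set.indicator_of_mem hp]
      nlinarith [cos_le_one_sub_sq_div_eight habs, sq_nonneg t]
    · rw [Set.indicator_of_notMem hp, sub_zero]
      exact Real.cos_le_one _
  have hmass : q * q ≤ (ν.prod ν).real E := by
    rw [measureReal_prod_prod]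
    gcongr
    exacts [hν.1, hν.2]
  have hind : Integrable (E.indicator fun _ => b ^ 2 / 2 * t ^ 2) (ν.prod ν) :=
    (integrable_const _).indicator hE
  have hint : Integrable (fun p : ℝ × ℝ => Real.cos (t * (p.1 - p.2))) (ν.prod ν) :=
    Integrable.of_bound (C := 1) (Continuous.aestronglyMeasurable (by fun_prop))
      (ae_of_all _ fun p => Real.abs_cos_le_one _)
  calc ‖charFun ν t‖ ^ 2
      = ∫ p : ℝ × ℝ, Real.cos (t * (p.1 - p.2)) ∂(ν.prod ν) := norm_charFun_sq_eq_integral_cos ν t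
    _ ≤ ∫ p, (1 - E.indicator (fun _ => b ^ 2 / 2 * t ^ 2) p) ∂(ν.prod ν) :=
        integral_mono hint ((integrable_const 1).sub hind) hcos
    _ = 1 - (ν.prod ν).real E * (b ^ 2 / 2 * t ^ 2) := by
        rw [integral_sub (integrable_const 1) hind, integral_indicator_const _ hE, integral_const,
          probReal_univ, smul_eq_mul, smul_eq_mul, mul_one]
    _ ≤ 1 - q ^ 2 * (b ^ 2 / 2 * t ^ 2) := by
        rw [sq q]
        gcongr

theorem IsTwoSided.norm_charFun_le {ν : Measure ℝ} [IsProbabilityMeasure ν] {b B q : ℝ}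
    (hν : IsTwoSided ν b B q) (hb : 0 ≤ b) (hq : 0 ≤ q) {t : ℝ} (ht : |t| * B ≤ 1) :
    ‖charFun ν t‖ ≤ Real.exp (-(q ^ 2 * b ^ 2 / 4 * t ^ 2)) := by
  refine le_of_sq_le_sq ?_ (Real.exp_pos _).le
  calc ‖charFun ν t‖ ^ 2 ≤ 1 - q ^ 2 * (b ^ 2 / 2 * t ^ 2) := hν.norm_charFun_sq_le hb hq ht
    _ = 2 * -(q ^ 2 * b ^ 2 / 4 * t ^ 2) + 1 := by ring
    _ ≤ Real.exp (2 * -(q ^ 2 * b ^ 2 / 4 * t ^ 2)) := Real.add_one_le_exp _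
    _ = Real.exp (-(q ^ 2 * b ^ 2 / 4 * t ^ 2)) ^ 2 := by rw [← Real.exp_nat_mul]; norm_num

section Sum

variable {A ι : Type*} [MeasurableSpace A] [Fintype ι] {P : Measure A}
  {Y : ι → A → ℝ} {b B q : ℝ}

theorem norm_charFun_map_sum_le [IsProbabilityMeasure P] (hY : ∀ i, Measurable (Y i))
    (hind : iIndepFun Y P) (htwo : ∀ i, IsTwoSided (P.map (Y i)) b B q) (hb : 0 ≤ b) (hq : 0 ≤ q)
    (t : ℝ) :
    ‖charFun (P.map fun a => ∑ i, Y i a) t‖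
      ≤ Real.exp (-(Fintype.card ι * (q ^ 2 * b ^ 2 / 4)) * t ^ 2) + B ^ 2 * t ^ 2 := by
  have hprob (i : ι) : IsProbabilityMeasure (P.map (Y i)) :=
    Measure.isProbabilityMeasure_map (hY i).aemeasurable
  rcases le_or_gt (|t| * B) 1 with ht | ht
  · rw [hind.charFun_map_fun_sum_eq_prod fun i => (hY i).aemeasurable, Finset.prod_apply, norm_prod]
    calc ∏ i, ‖charFun (P.map (Y i)) t‖
        ≤ ∏ _i : ι, Real.exp (-(q ^ 2 * b ^ 2 / 4 * t ^ 2)) :=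
          Finset.prod_le_prod (fun i _ => norm_nonneg _)
            fun i _ => (htwo i).norm_charFun_le hb hq ht
      _ = Real.exp (-(Fintype.card ι * (q ^ 2 * b ^ 2 / 4)) * t ^ 2) := by
          rw [Finset.prod_const, Finset.card_univ, ← Real.exp_nat_mul]
          ring_nf
      _ ≤ _ := le_add_of_nonneg_right (by positivity)
  · have hprob_sum : IsProbabilityMeasure (P.map fun a => ∑ i, Y i a) :=
      Measure.isProbabilityMeasure_map (Finset.measurable_fun_sum _ fun i _ => hY i).aemeasurable
    calc ‖charFun (P.map fun a => ∑ i, Y i a) t‖ ≤ 1 := norm_charFun_le_one t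
      _ ≤ (|t| * B) ^ 2 := one_le_pow₀ ht.le
      _ = B ^ 2 * t ^ 2 := by rw [mul_pow, sq_abs, mul_comm]
      _ ≤ _ := le_add_of_nonneg_left (Real.exp_pos _).le

theorem measureReal_abs_sum_sub_le [Nonempty ι] [IsProbabilityMeasure P]
    (hY : ∀ i, Measurable (Y i)) (hind : iIndepFun Y P)
    (htwo : ∀ i, IsTwoSided (P.map (Y i)) b B q) (hb : 0 < b) (hq : 0 < q) {ε : ℝ} (hε : 0 < ε)
    (c : ℝ) :
    P.real {a | |∑ i, Y i a - c| ≤ ε}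
      ≤ 2 * (2 * ε / (q * b * √(Fintype.card ι)) + (B / ε) ^ 2) := by
  set N : ℝ := Nat.cast (Fintype.card ι)
  have hN : 0 < N := Nat.cast_pos.mpr Fintype.card_pos
  set β : ℝ := N * (q ^ 2 * b ^ 2 / 4) / ε ^ 2 with hβ
  have hsum : Measurable fun a => ∑ i, Y i a := Finset.measurable_fun_sum _ fun i _ => hY i
  have hβpos : 0 < β := by positivity
  have hexp := integrable_exp_neg_mul_sq_gaussianReal hβpos.le
  have hsq := integrable_sq_gaussianReal.const_mul ((B / ε) ^ 2)
  have hsqrt : 1 / √(2 * β) ≤ 2 * ε / (q * b * √N) := by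
    rw [← one_div_div (q * b * √N)]
    refine one_div_le_one_div_of_le (by positivity) (Real.le_sqrt_of_sq_le ?_)
    have : (q * b * √N / (2 * ε)) ^ 2 = β := by
      rw [hβ, div_pow, mul_pow _ (√N), Real.sq_sqrt hN.le]
      ring
    linarith
  calc P.real {a | |∑ i, Y i a - c| ≤ ε}
      = (P.map fun a => ∑ i, Y i a).real (Metric.closedBall c ε) := by
        rw [map_measureReal_apply hsum Metric.isClosed_closedBall.measurableSet]
        rfl
    _ ≤ 2 * ∫ s, ‖charFun (P.map fun a => ∑ i, Y i a) (s / ε)‖ ∂(gaussianReal 0 1) :=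
        measureReal_closedBall_le_integral_norm_charFun _ c hε
    _ ≤ 2 * ∫ s, (Real.exp (-β * s ^ 2) + (B / ε) ^ 2 * s ^ 2) ∂(gaussianReal 0 1) := by
        refine mul_le_mul_of_nonneg_left (integral_mono_of_nonneg
          (ae_of_all _ fun s => norm_nonneg _) (hexp.add hsq) (ae_of_all _ fun s => ?_)) zero_le_two
        refine (norm_charFun_map_sum_le hY hind htwo hb.le hq.le (s / ε)).trans_eq ?_
        congr 1
        · congr 1
          ring
        · ring
    _ ≤ _ := by
        rw [integral_add hexp hsq, integral_const_mul, integral_sq_gaussianReal]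
        linarith [integral_exp_neg_mul_sq_gaussianReal_le hβpos]

end Sum

/-! ### Uniform permutations -/

theorem measureReal_uniformOn {α : Type*} [MeasurableSpace α] [MeasurableSingletonClass α]
    {s : Set α} (hs : s.Finite) (t : Set α) :
    (uniformOn s).real t = (s ∩ t).ncard / s.ncard := by
  have hst : (s ∩ t).Finite := hs.inter_of_left t
  rw [measureReal_def, uniformOn, cond_apply hs.measurableSet,
    Measure.count_apply hs.measurableSet, Measure.count_apply hst.measurableSet,
    ← hs.cast_ncard_eq, ← hst.cast_ncard_eq]
  simp [div_eq_inv_mul]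

theorem integral_uniformOn_univ {α : Type*} [MeasurableSpace α] [MeasurableSingletonClass α]
    [Fintype α] (f : α → ℝ) :
    ∫ a, f a ∂(uniformOn Set.univ) = (Fintype.card α : ℝ)⁻¹ * ∑ a, f a := by
  rw [integral_fintype .of_finite, Finset.mul_sum]
  refine Finset.sum_congr rfl fun a _ => ?_
  rw [measureReal_uniformOn Set.finite_univ, Set.univ_inter, Set.ncard_singleton, Set.ncard_univ,
    Nat.card_eq_fintype_card, Nat.cast_one, one_div, smul_eq_mul]

theorem map_smul_uniformOn_univ {G α : Type*} [Group G] [Finite G] [MulAction G α]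
    [MeasurableSpace G] [DiscreteMeasurableSpace G] [MeasurableSpace α] [Countable α]
    [MeasurableSingletonClass α] (x : α) :
    (uniformOn (Set.univ : Set G)).map (· • x) = uniformOn (MulAction.orbit G x) := by
  have horbit : (MulAction.orbit G x).Finite := Set.finite_range _
  refine ext_iff_measureReal_singleton.mpr fun y => ?_
  rw [map_measureReal_apply .of_discrete (measurableSet_singleton y),
    measureReal_uniformOn Set.finite_univ, measureReal_uniformOn horbit, Set.univ_inter]
  by_cases hy : y ∈ MulAction.orbit G x
  · obtain ⟨h, rfl⟩ := hy
    have hfibre : (· • x) ⁻¹' {h • x} = (h * ·) '' (MulAction.stabilizer G x : Set G) := by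
      ext g
      simp [MulAction.mem_stabilizer_iff, mul_smul, inv_smul_eq_iff]
    have hcard : (MulAction.stabilizer G x : Set G).ncard * (MulAction.orbit G x).ncard
        = Nat.card G := by
      rw [← MulAction.index_stabilizer]
      exact (MulAction.stabilizer G x).card_mul_index
    have hstab : (MulAction.stabilizer G x : Set G).ncard ≠ 0 :=
      ((Set.ncard_pos).mpr ⟨1, one_mem (MulAction.stabilizer G x)⟩).ne'
    rw [hfibre, Set.ncard_image_of_injective _ (mul_right_injective h), Set.ncard_univ, ← hcard,
      Set.inter_singleton_of_mem (MulAction.mem_orbit x h), Set.ncard_singleton, Nat.cast_mul,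
      Nat.cast_one, div_mul_cancel_left₀ (Nat.cast_ne_zero.mpr hstab), one_div]
  · have hfibre : (· • x) ⁻¹' {y} = (∅ : Set G) :=
      Set.eq_empty_of_forall_notMem fun g hg => hy ⟨g, hg⟩
    rw [hfibre, Set.inter_singleton_eq_empty.mpr hy]
    simp

theorem map_perm_apply_uniformOn_univ {n : ℕ} (i : Fin n) :
    (uniformOn (Set.univ : Set (Equiv.Perm (Fin n)))).map (fun σ => σ i)
      = uniformOn Set.univ := by
  rw [← MulAction.orbit_eq_univ (Equiv.Perm (Fin n)) i]
  exact map_smul_uniformOn_univ i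

theorem orbit_perm_pair {α : Type*} {i j : α} (hij : i ≠ j) :
    MulAction.orbit (Equiv.Perm α) (i, j) = (Set.univ : Set α).offDiag := by
  ext ⟨k, l⟩
  rw [Set.mem_offDiag]
  constructor
  · rintro ⟨σ, h⟩
    obtain ⟨rfl, rfl⟩ := Prod.mk.inj h
    exact ⟨trivial, trivial, σ.injective.ne hij⟩
  · rintro ⟨-, -, hkl⟩
    obtain ⟨σ, hi, hj⟩ := MulAction.is_two_pretransitive_iff.mp
      (Equiv.Perm.isMultiplyPretransitive α 2) hij hkl
    exact ⟨σ, Prod.ext hi hj⟩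

theorem map_perm_pair_uniformOn_univ {n : ℕ} {i j : Fin n} (hij : i ≠ j) :
    (uniformOn (Set.univ : Set (Equiv.Perm (Fin n)))).map (fun σ => (σ i, σ j))
      = uniformOn (Set.univ : Set (Fin n)).offDiag := by
  rw [← orbit_perm_pair hij]
  exact map_smul_uniformOn_univ (i, j)

theorem ncard_mul_ncard_sub_one_le {α : Type*} [Finite α] (s t : Set α) :
    (s.ncard : ℝ) * (t.ncard - 1) ≤ (Set.univ.offDiag ∩ s ×ˢ t).ncard := by
  have hdiff : s ×ˢ t \ (fun a => (a, a)) '' s ⊆ Set.univ.offDiag ∩ s ×ˢ t := by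
    rintro ⟨a, b⟩ ⟨hst, hab⟩
    exact ⟨⟨trivial, trivial, fun h => hab ⟨a, hst.1, Prod.ext rfl h⟩⟩, hst⟩
  have hle : s.ncard * t.ncard ≤ (Set.univ.offDiag ∩ s ×ˢ t).ncard + s.ncard :=
    calc s.ncard * t.ncard = (s ×ˢ t).ncard := Set.ncard_prod.symm
      _ ≤ (s ×ˢ t \ (fun a => (a, a)) '' s).ncard + ((fun a => (a, a)) '' s).ncard :=
        Set.ncard_le_ncard_sdiff_add_ncard _ _
      _ ≤ _ := Nat.add_le_add (Set.ncard_le_ncard hdiff) (Set.ncard_image_le)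
  have : (s.ncard : ℝ) * t.ncard ≤ (Set.univ.offDiag ∩ s ×ˢ t).ncard + s.ncard := mod_cast hle
  linarith

theorem measureReal_mul_sub_le_measureReal_perm {n : ℕ} {i j : Fin n} (hij : i ≠ j)
    (s t : Set (Fin n)) :
    (uniformOn Set.univ).real s * ((uniformOn Set.univ).real t - 1 / n)
      ≤ (uniformOn Set.univ).real {σ : Equiv.Perm (Fin n) | σ i ∈ s ∧ σ j ∈ t} := by
  have hn : (0 : ℝ) < n := Nat.cast_pos.mpr i.pos
  have hpos : 0 < (Set.univ : Set (Fin n)).offDiag.ncard :=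
    (Set.ncard_pos (Set.toFinite _)).mpr ⟨(i, j), trivial, trivial, hij⟩
  have hcard : ((Set.univ : Set (Fin n)).offDiag.ncard : ℝ) ≤ n * n := by
    have := Set.ncard_le_card (Set.univ : Set (Fin n)).offDiag
    rw [Nat.card_prod, Nat.card_fin] at this
    exact_mod_cast this
  have hlaw : (uniformOn Set.univ).real {σ : Equiv.Perm (Fin n) | σ i ∈ s ∧ σ j ∈ t}
      = (Set.univ.offDiag ∩ s ×ˢ t).ncard / (Set.univ : Set (Fin n)).offDiag.ncard := by
    rw [← measureReal_uniformOn (Set.toFinite _), ← map_perm_pair_uniformOn_univ hij,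
      map_measureReal_apply .of_discrete .of_discrete]
    rfl
  rw [hlaw, measureReal_uniformOn Set.finite_univ, measureReal_uniformOn Set.finite_univ,
    Set.univ_inter, Set.univ_inter, Set.ncard_univ, Nat.card_fin]
  calc (s.ncard : ℝ) / n * (t.ncard / n - 1 / n)
      = s.ncard * (t.ncard - 1) / (n * n) := by field_simp
    _ ≤ (Set.univ.offDiag ∩ s ×ˢ t).ncard / (n * n) := by
        gcongr
        exact ncard_mul_ncard_sub_one_le s t
    _ ≤ _ := by gcongr

theorem IsTwoSided.map_mul_perm {n : ℕ} {a : Fin n → ℝ} {b B q : ℝ}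
    (ha : IsTwoSided ((uniformOn Set.univ).map a) b B q) (hb : 0 ≤ b) (hq : 0 ≤ q)
    (hn : 2 ≤ q * n) {i j : Fin n} (hij : i ≠ j) :
    IsTwoSided ((uniformOn Set.univ).map fun σ : Equiv.Perm (Fin n) => a (σ i) * a (σ j))
      (b ^ 2) (B ^ 2) (q ^ 2 / 2) := by
  have hn' : (0 : ℝ) < n := Nat.cast_pos.mpr i.pos
  rw [IsTwoSided, map_measureReal_apply .of_discrete measurableSet_Icc,
    map_measureReal_apply .of_discrete measurableSet_Icc] at ha
  have hpair (s t : Set (Fin n)) (hs : q ≤ (uniformOn Set.univ).real s)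
      (ht : q ≤ (uniformOn Set.univ).real t) :
      q ^ 2 / 2 ≤ (uniformOn Set.univ).real {σ : Equiv.Perm (Fin n) | σ i ∈ s ∧ σ j ∈ t} := by
    have hinv : 1 / (n : ℝ) ≤ q / 2 := by
      rw [div_le_div_iff₀ hn' two_pos]
      linarith
    refine le_trans ?_ (measureReal_mul_sub_le_measureReal_perm hij s t)
    calc q ^ 2 / 2 = q * (q - q / 2) := by ring
      _ ≤ _ := by gcongr; linarith
  rw [IsTwoSided, map_measureReal_apply .of_discrete measurableSet_Icc,
    map_measureReal_apply .of_discrete measurableSet_Icc]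
  refine ⟨(hpair _ _ ha.1 ha.1).trans (measureReal_mono ?_),
    (hpair _ _ ha.1 ha.2).trans (measureReal_mono ?_)⟩
  · rintro σ ⟨⟨h₁, h₂⟩, ⟨h₃, h₄⟩⟩
    constructor <;> nlinarith
  · rintro σ ⟨⟨h₁, h₂⟩, ⟨h₃, h₄⟩⟩
    constructor <;> nlinarith

/-! ### Two-sidedness from moments -/

theorem abs_add_self_div_two_le_indicator {V q : ℝ} (hV : 0 < V) (hq : 0 < q) (x : ℝ) :
    (|x| + x) / 2 ≤ q / 4 + q / (4 * V) * x ^ 2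
      + (Set.Icc (q / 4) (4 * V / q)).indicator (fun _ => 4 * V / q) x := by
  have hVq : 0 < 4 * V / q := by positivity
  have hsq_nonneg : 0 ≤ q / (4 * V) * x ^ 2 := by positivity
  have hind : 0 ≤ (Set.Icc (q / 4) (4 * V / q)).indicator (fun _ => 4 * V / q) x :=
    Set.indicator_nonneg (fun _ _ => hVq.le) x
  rcases le_or_gt x 0 with hx | hx
  · rw [abs_of_nonpos hx]
    linarith
  rw [abs_of_pos hx, add_self_div_two]
  rcases lt_or_ge x (q / 4) with hl | hl
  · linarith
  rcases lt_or_ge (4 * V / q) x with hu | hu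
  · have : x ≤ q / (4 * V) * x ^ 2 := by
      rw [div_lt_iff₀ hq] at hu
      rw [div_mul_eq_mul_div, le_div_iff₀ (by positivity)]
      nlinarith
    linarith
  · rw [Set.indicator_of_mem (show x ∈ Set.Icc (q / 4) (4 * V / q) from ⟨hl, hu⟩)]
    linarith

-- A Paley–Zygmund argument: off `[q / 4, 4 * V / q]` the positive part of `x` is bounded by
-- `q / 4 + q / (4 * V) * x ^ 2`, which accounts for only half of its mean.
theorem measureReal_Icc_ge_of_integral_abs_ge {ν : Measure ℝ} [IsProbabilityMeasure ν]
    (hν : MemLp id 2 ν) (hmean : ∫ x, x ∂ν = 0) {V q : ℝ} (hV : 0 < V) (hq : 0 < q)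
    (hsq : ∫ x, x ^ 2 ∂ν ≤ V) (habs : 2 * q ≤ ∫ x, |x| ∂ν) :
    q ^ 2 / (8 * V) ≤ ν.real (Set.Icc (q / 4) (4 * V / q)) := by
  set I := Set.Icc (q / 4) (4 * V / q)
  have hint : Integrable (fun x : ℝ => x) ν := hν.integrable one_le_two
  have hsq_int : Integrable (fun x : ℝ => x ^ 2) ν := hν.integrable_sq
  have hint_sq : Integrable (fun x : ℝ => q / 4 + q / (4 * V) * x ^ 2) ν :=
    (integrable_const _).add (hsq_int.const_mul _)
  have hint_ind : Integrable (I.indicator fun _ => 4 * V / q) ν :=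
    (integrable_const _).indicator measurableSet_Icc
  have hle := integral_mono ((hint.abs.add hint).div_const 2) (hint_sq.add hint_ind)
    (abs_add_self_div_two_le_indicator hV hq)
  simp only [Pi.add_apply] at hle
  rw [integral_div, integral_add hint.abs hint, hmean, integral_add hint_sq hint_ind,
    integral_add (integrable_const _) (hsq_int.const_mul _), integral_const_mul,
    integral_const, integral_indicator_const _ measurableSet_Icc, probReal_univ, one_smul,
    smul_eq_mul] at hle
  have hsecond : q / (4 * V) * ∫ x, x ^ 2 ∂ν ≤ q / 4 :=
    (mul_le_mul_of_nonneg_left hsq (by positivity)).trans_eq (by field_simp)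
  have hmass : q / 2 ≤ ν.real I * (4 * V / q) := by linarith
  rw [← mul_div_assoc, le_div_iff₀ hq] at hmass
  rw [div_le_iff₀ (by positivity)]
  linarith

theorem isTwoSided_of_integral_abs_ge {ν : Measure ℝ} [IsProbabilityMeasure ν]
    (hν : MemLp id 2 ν) (hmean : ∫ x, x ∂ν = 0) {V q : ℝ} (hV : 0 < V) (hq : 0 < q)
    (hsq : ∫ x, x ^ 2 ∂ν ≤ V) (habs : 2 * q ≤ ∫ x, |x| ∂ν) :
    IsTwoSided ν (q / 4) (4 * V / q) (q ^ 2 / (8 * V)) := by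
  refine ⟨measureReal_Icc_ge_of_integral_abs_ge hν hmean hV hq hsq habs, ?_⟩
  have hprob : IsProbabilityMeasure (ν.map Neg.neg) :=
    Measure.isProbabilityMeasure_map measurable_neg.aemeasurable
  have hneg := measureReal_Icc_ge_of_integral_abs_ge (ν := ν.map Neg.neg)
    ((memLp_map_measure_iff (by fun_prop) (by fun_prop)).mpr hν.neg)
    (by rw [integral_map (by fun_prop) (by fun_prop), integral_neg, hmean, neg_zero]) hV hq
    (by rw [integral_map (by fun_prop) (by fun_prop)]; simpa only [neg_sq] using hsq)
    (by rw [integral_map (by fun_prop) (by fun_prop)]; simpa only [abs_neg] using habs)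
  rwa [map_measureReal_apply measurable_neg measurableSet_Icc, Set.neg_preimage,
    Set.neg_Icc] at hneg

theorem sq_le_mul_abs_add_rpow {δ B : ℝ} (hδ : 0 ≤ δ) (hB : 0 < B) (x : ℝ) :
    x ^ 2 ≤ B * |x| + B ^ (-δ) * |x| ^ (2 + δ) := by
  rw [← sq_abs]
  rcases le_or_gt |x| B with hx | hx
  · have : 0 ≤ B ^ (-δ) * |x| ^ (2 + δ) := by positivity
    nlinarith [abs_nonneg x]
  · have hx0 : 0 < |x| := hB.trans hx
    have hratio : 1 ≤ B ^ (-δ) * |x| ^ δ := by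
      rw [Real.rpow_neg hB.le, inv_mul_eq_div, one_le_div (by positivity)]
      exact Real.rpow_le_rpow hB.le hx.le hδ
    rw [Real.rpow_add hx0, Real.rpow_two]
    have := mul_le_mul_of_nonneg_left hratio (sq_nonneg |x|)
    nlinarith [mul_pos hB hx0]

section Moments

variable {A : Type*} [MeasurableSpace A] {μ : Measure A} {Y : A → ℝ}

theorem integrable_abs_rpow {p : ℝ} (hp : 0 < p) (hY : MemLp Y (ENNReal.ofReal p) μ) :
    Integrable (fun a => |Y a| ^ p) μ := by
  simpa only [Real.norm_eq_abs, ENNReal.toReal_ofReal hp.le]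
    using hY.integrable_norm_rpow (ENNReal.ofReal_pos.mpr hp).ne' ENNReal.ofReal_ne_top

theorem abs_integral_rpow_le [IsProbabilityMeasure μ] {p : ℝ} (hp : 1 ≤ p)
    (hY : MemLp Y (ENNReal.ofReal p) μ) :
    |∫ a, Y a ∂μ| ^ p ≤ ∫ a, |Y a| ^ p ∂μ := by
  have hp0 : 0 < p := by linarith
  have hrpow := integrable_abs_rpow hp0 hY
  have habs : Integrable (fun a => |Y a|) μ := (hY.integrable (by simpa using hp)).abs
  calc |∫ a, Y a ∂μ| ^ p ≤ (∫ a, |Y a| ∂μ) ^ p := by gcongr; exact abs_integral_le_integral_abs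
    _ ≤ ∫ a, |Y a| ^ p ∂μ :=
        (convexOn_rpow hp).map_integral_le (Real.continuous_rpow_const hp0.le).continuousOn
          isClosed_Ici (ae_of_all _ fun a => abs_nonneg (Y a)) habs hrpow

theorem integral_abs_sub_integral_rpow_le [IsProbabilityMeasure μ] {p : ℝ} (hp : 1 ≤ p)
    (hY : MemLp Y (ENNReal.ofReal p) μ) :
    ∫ a, |Y a - ∫ a', Y a' ∂μ| ^ p ∂μ ≤ 2 ^ p * ∫ a, |Y a| ^ p ∂μ := by
  have hp0 : 0 < p := by linarith
  set c := ∫ a, Y a ∂μ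
  have hrpow := integrable_abs_rpow hp0 hY
  have hcentred := integrable_abs_rpow hp0 (hY.sub (memLp_const c))
  have hpoint (a : A) : |Y a - c| ^ p ≤ 2 ^ (p - 1) * (|Y a| ^ p + |c| ^ p) := by
    have h := Real.rpow_sum_le_const_mul_sum_rpow Finset.univ ![Y a, c] hp
    simp only [Fin.sum_univ_two, Matrix.cons_val_zero, Matrix.cons_val_one, Finset.card_univ,
      Fintype.card_fin] at h
    exact (Real.rpow_le_rpow (abs_nonneg _) (abs_sub (Y a) c) hp0.le).trans h
  calc ∫ a, |Y a - c| ^ p ∂μ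
      ≤ ∫ a, 2 ^ (p - 1) * (|Y a| ^ p + |c| ^ p) ∂μ :=
        integral_mono hcentred ((hrpow.add (integrable_const _)).const_mul _) hpoint
    _ = 2 ^ (p - 1) * (∫ a, |Y a| ^ p ∂μ + |c| ^ p) := by
        rw [integral_const_mul, integral_add hrpow (integrable_const _), integral_const,
          probReal_univ, one_smul]
    _ ≤ 2 ^ (p - 1) * (∫ a, |Y a| ^ p ∂μ + ∫ a, |Y a| ^ p ∂μ) := by
        gcongr
        exact abs_integral_rpow_le hp hY
    _ = 2 ^ p * ∫ a, |Y a| ^ p ∂μ := by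
        rw [Real.rpow_sub_one two_ne_zero]
        ring

theorem integral_sq_le_integral_rpow_add_one [IsProbabilityMeasure μ] {p : ℝ} (hp : 2 ≤ p)
    (hY : MemLp Y (ENNReal.ofReal p) μ) :
    ∫ a, Y a ^ 2 ∂μ ≤ ∫ a, |Y a| ^ p ∂μ + 1 := by
  have hrpow := integrable_abs_rpow (by linarith) hY
  have hY₂ : MemLp Y 2 μ := hY.mono_exponent (by simpa using hp)
  have hpoint (a : A) : Y a ^ 2 ≤ |Y a| ^ p + 1 := by
    rw [← sq_abs]
    rcases le_or_gt |Y a| 1 with ha | ha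
    · have := pow_le_one₀ (n := 2) (abs_nonneg (Y a)) ha
      have : 0 ≤ |Y a| ^ p := by positivity
      linarith
    · have := Real.rpow_le_rpow_of_exponent_le ha.le hp
      rw [Real.rpow_two] at this
      linarith
  calc ∫ a, Y a ^ 2 ∂μ ≤ ∫ a, (|Y a| ^ p + 1) ∂μ :=
        integral_mono hY₂.integrable_sq (hrpow.add (integrable_const 1)) hpoint
    _ = ∫ a, |Y a| ^ p ∂μ + 1 := by
        rw [integral_add hrpow (integrable_const 1), integral_const, probReal_univ, one_smul]

end Moments

theorem exists_le_integral_abs {δ v K : ℝ} (hδ : 0 < δ) (hv : 0 < v) :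
    ∃ q > 0, ∀ (ν : Measure ℝ) [IsProbabilityMeasure ν], MemLp id (ENNReal.ofReal (2 + δ)) ν →
      v ≤ ∫ x, x ^ 2 ∂ν → ∫ x, |x| ^ (2 + δ) ∂ν ≤ K → 2 * q ≤ ∫ x, |x| ∂ν := by
  obtain ⟨B, hB, hBK⟩ : ∃ B : ℝ, 0 < B ∧ B ^ (-δ) * K ≤ v / 2 := by
    have hlim := (tendsto_rpow_neg_atTop hδ).mul_const K
    rw [zero_mul] at hlim
    exact ((eventually_gt_atTop 0).and (hlim.eventually_le_const (by positivity))).exists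
  refine ⟨v / (4 * B), by positivity, fun ν _ hν hsq hK => ?_⟩
  have hrpow : Integrable (fun x : ℝ => |x| ^ (2 + δ)) ν := integrable_abs_rpow (by linarith) hν
  have hν₂ : MemLp id 2 ν := hν.mono_exponent (by simpa using hδ.le)
  have habs : Integrable (fun x : ℝ => |x|) ν := (hν₂.integrable one_le_two).abs
  have hinterp : v ≤ B * ∫ x, |x| ∂ν + v / 2 :=
    calc v ≤ ∫ x, x ^ 2 ∂ν := hsq
      _ ≤ ∫ x, (B * |x| + B ^ (-δ) * |x| ^ (2 + δ)) ∂ν :=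
          integral_mono hν₂.integrable_sq ((habs.const_mul _).add (hrpow.const_mul _))
            (sq_le_mul_abs_add_rpow hδ.le hB)
      _ = B * ∫ x, |x| ∂ν + B ^ (-δ) * ∫ x, |x| ^ (2 + δ) ∂ν := by
          rw [integral_add (habs.const_mul _) (hrpow.const_mul _), integral_const_mul,
            integral_const_mul]
      _ ≤ B * ∫ x, |x| ∂ν + v / 2 := by
          gcongr
          exact (mul_le_mul_of_nonneg_left hK (by positivity)).trans hBK
  rw [← mul_div_assoc, div_le_iff₀ (by positivity)]
  linarith

theorem exists_isTwoSided {δ v K : ℝ} (hδ : 0 < δ) (hv : 0 < v) :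
    ∃ b > 0, ∃ B, ∃ q > 0, ∀ (ν : Measure ℝ) [IsProbabilityMeasure ν],
      MemLp id (ENNReal.ofReal (2 + δ)) ν → ∫ x, x ∂ν = 0 → v ≤ ∫ x, x ^ 2 ∂ν →
      ∫ x, |x| ^ (2 + δ) ∂ν ≤ K → IsTwoSided ν b B q := by
  obtain ⟨q, hq, habs⟩ := exists_le_integral_abs (K := K) hδ hv
  have hV : 0 < |K| + 1 := by positivity
  refine ⟨q / 4, by positivity, 4 * (|K| + 1) / q, q ^ 2 / (8 * (|K| + 1)), by positivity,
    fun ν _ hν hmean hsq hK => ?_⟩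
  refine isTwoSided_of_integral_abs_ge (hν.mono_exponent (by simpa using hδ.le)) hmean hV hq ?_
    (habs ν hν hsq hK)
  have hsq_le : ∫ x, x ^ 2 ∂ν ≤ ∫ x, |x| ^ (2 + δ) ∂ν + 1 :=
    integral_sq_le_integral_rpow_add_one (by linarith) hν
  linarith [le_abs_self K]

theorem exists_isTwoSided_map_sub_integral {δ v K : ℝ} (hδ : 0 < δ) (hv : 0 < v) :
    ∃ b > 0, ∃ B, ∃ q > 0, ∀ {A : Type*} [MeasurableSpace A] (μ : Measure A)
      [IsProbabilityMeasure μ] {Y : A → ℝ}, MemLp Y (ENNReal.ofReal (2 + δ)) μ → v ≤ Var[Y; μ] →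
      ∫ a, |Y a| ^ (2 + δ) ∂μ ≤ K → IsTwoSided (μ.map fun a => Y a - ∫ a', Y a' ∂μ) b B q := by
  obtain ⟨b, hb, B, q, hq, htwo⟩ := exists_isTwoSided (K := 2 ^ (2 + δ) * K) hδ hv
  refine ⟨b, hb, B, q, hq, fun {A} _ μ _ {Y} hY hvar hK => ?_⟩
  have hYc : MemLp (fun a => Y a - ∫ a', Y a' ∂μ) (ENNReal.ofReal (2 + δ)) μ :=
    hY.sub (memLp_const _)
  have hmeas : AEMeasurable (fun a => Y a - ∫ a', Y a' ∂μ) μ :=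
    hYc.aestronglyMeasurable.aemeasurable
  have hint : Integrable Y μ := hY.integrable (by simpa using by linarith)
  have hprob := Measure.isProbabilityMeasure_map hmeas
  refine htwo _ ((memLp_map_measure_iff (by fun_prop) hmeas).mpr hYc) ?_ ?_ ?_
  · rw [integral_map hmeas (by fun_prop), integral_sub hint (integrable_const _), integral_const,
      probReal_univ, one_smul, sub_self]
  · rwa [integral_map hmeas (by fun_prop), ← variance_eq_integral hint.aemeasurable]
  · have hcont : Continuous fun x : ℝ => |x| ^ (2 + δ) :=
      continuous_abs.rpow_const fun _ => Or.inr (by linarith)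
    rw [integral_map hmeas hcont.aestronglyMeasurable]
    refine (integral_abs_sub_integral_rpow_le (by linarith) hY).trans ?_
    gcongr

/-! ### The statistics of a fixed data set -/

section Data

variable {n m R : ℕ} (x : Fin n → Fin m → ℝ) (k : Fin m)

theorem sampleMean_apply_eq_integral : sampleMean x k = ∫ i, x i k ∂(uniformOn Set.univ) := by
  simp only [sampleMean, Pi.smul_apply, Finset.sum_apply, smul_eq_mul, integral_uniformOn_univ,
    Fintype.card_fin]

theorem sampleVar_apply_self_eq_variance :
    sampleVar x k k = Var[fun i => x i k; uniformOn Set.univ] := by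
  rw [variance_eq_integral .of_discrete, ← sampleMean_apply_eq_integral, integral_uniformOn_univ]
  simp only [sampleVar, Matrix.smul_apply, Matrix.sum_apply, Matrix.vecMulVec_apply, Pi.sub_apply,
    smul_eq_mul, Fintype.card_fin, sq]

theorem integral_abs_apply_rpow_le {p : ℝ} (hp : 0 ≤ p) :
    ∫ i, |x i k| ^ p ∂(uniformOn Set.univ) ≤ (n : ℝ)⁻¹ * ∑ i, ‖x i‖ ^ p := by
  rw [integral_uniformOn_univ, Fintype.card_fin]
  gcongr with i
  exact norm_le_pi_norm (x i) k

theorem draw_of_lt (σ : Equiv.Perm (Fin n)) {j : ℕ} (hj : j < n) : draw x σ j = x (σ ⟨j, hj⟩) :=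
  dif_pos hj

theorem integral_perm_apply (f : Fin n → ℝ) (i : Fin n) :
    ∫ σ : Equiv.Perm (Fin n), f (σ i) ∂(uniformOn Set.univ) = ∫ j, f j ∂(uniformOn Set.univ) := by
  rw [← map_perm_apply_uniformOn_univ i, integral_map .of_discrete .of_discrete]

theorem sqrt_div_eq_mul (R m : ℕ) : √((R : ℝ) / m) = 1 / √((m : ℝ) * R) * R := by
  rw [Real.sqrt_div R.cast_nonneg, Real.sqrt_mul m.cast_nonneg, one_div_mul_eq_div,
    div_mul_eq_div_div_swap, Real.div_sqrt]

theorem uStat_sub_lambdaHat (π : Fin R → Equiv.Perm (Fin n)) :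
    uStat x k 0 π - lambdaHat x k π = uStat x k (sampleMean x k) π := by
  have hsum (μ v : ℝ) : ∑ r, (draw x (π r) 0 k - μ) * v * (draw x (π r) 1 k - μ)
      = v * (∑ r, draw x (π r) 0 k * draw x (π r) 1 k
        - μ * ∑ r, (draw x (π r) 0 k + draw x (π r) 1 k) + R * μ ^ 2) := by
    have hconst : (R : ℝ) * μ ^ 2 = ∑ _r : Fin R, μ ^ 2 := by simp
    rw [hconst, Finset.mul_sum, ← Finset.sum_sub_distrib, ← Finset.sum_add_distrib, Finset.mul_sum]
    exact Finset.sum_congr rfl fun r _ => by ring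
  simp only [uStat, lambdaHat, hsum, sqrt_div_eq_mul]
  ring

theorem lambdaHat_eq_sum_add (π : Fin R → Equiv.Perm (Fin n)) :
    lambdaHat x k π
      = ∑ r, sampleMean x k * (sampleVar x k k)⁻¹ * (1 / √((m : ℝ) * R))
          * ((draw x (π r) 0 k - sampleMean x k) + (draw x (π r) 1 k - sampleMean x k))
        + √((R : ℝ) / m) * (sampleVar x k k)⁻¹ * sampleMean x k ^ 2 := by
  have hsum (c : ℝ) : ∑ r, ((draw x (π r) 0 k - c) + (draw x (π r) 1 k - c))
      = ∑ r, (draw x (π r) 0 k + draw x (π r) 1 k) - R * (2 * c) := by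
    have hconst : (R : ℝ) * (2 * c) = ∑ _r : Fin R, 2 * c := by simp
    rw [hconst, ← Finset.sum_sub_distrib]
    exact Finset.sum_congr rfl fun r _ => by ring
  rw [← Finset.mul_sum, hsum, lambdaHat, sqrt_div_eq_mul]
  ring

end Data

/-! ### Anticoncentration of the centred U-type statistic -/

theorem measureReal_pi_abs_sum_sub_le {S ι : Type*} [MeasurableSpace S] [Fintype ι] [Nonempty ι]
    {μ : Measure S} [IsProbabilityMeasure μ] {w : S → ℝ} (hw : Measurable w) {b B q : ℝ}
    (htwo : IsTwoSided (μ.map w) b B q) (hb : 0 < b) (hq : 0 < q) {ε : ℝ} (hε : 0 < ε) (c : ℝ) :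
    (Measure.pi fun _ : ι => μ).real {s | |∑ i, w (s i) - c| ≤ ε}
      ≤ 2 * (2 * ε / (q * b * √(Fintype.card ι)) + (B / ε) ^ 2) := by
  have hind : iIndepFun (fun i (s : ι → S) => w (s i)) (Measure.pi fun _ => μ) :=
    iIndepFun_pi fun _ => hw.aemeasurable
  have hmeas (i : ι) : Measurable fun s : ι → S => w (s i) := hw.comp (measurable_pi_apply i)
  have hlaw (i : ι) : (Measure.pi fun _ => μ).map (fun s : ι → S => w (s i)) = μ.map w :=
    (Measure.map_map hw (measurable_pi_apply i)).symm.trans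
      (congrArg (Measure.map w) (measurePreserving_eval (fun _ : ι => μ) i).map_eq)
  have htwo' (i : ι) : IsTwoSided ((Measure.pi fun _ => μ).map fun s : ι → S => w (s i)) b B q := by
    rw [hlaw i]
    exact htwo
  exact measureReal_abs_sum_sub_le hmeas hind htwo' hb hq hε c

instance isProbabilityMeasure_drawLaw (n R : ℕ) : IsProbabilityMeasure (drawLaw n R) :=
  inferInstanceAs (IsProbabilityMeasure (Measure.pi fun _ => uniformOn Set.univ))

theorem exists_isTwoSided_draw_mul_draw {m : ℕ} {δ L M : ℝ} (hδ : 0 < δ) (hL : 0 < L) :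
    ∃ b > 0, ∃ B, ∃ q > 0, ∃ N : ℕ, ∀ n ≥ N, ∀ (x : Fin n → Fin m → ℝ) (k : Fin m),
      L ≤ sampleVar x k k → (n : ℝ)⁻¹ * ∑ i, ‖x i‖ ^ (2 + δ) ≤ M →
      IsTwoSided ((uniformOn Set.univ).map fun σ =>
        (draw x σ 0 k - sampleMean x k) * (draw x σ 1 k - sampleMean x k)) b B q := by
  obtain ⟨b, hb, B, q, hq, htwo⟩ := exists_isTwoSided_map_sub_integral (K := M) hδ hL
  obtain ⟨N, hN⟩ := exists_nat_ge (2 / q)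
  refine ⟨b ^ 2, by positivity, B ^ 2, q ^ 2 / 2, by positivity, max N 2,
    fun n hn x k hvar hmoment => ?_⟩
  have hn2 : 2 ≤ n := le_of_max_le_right hn
  have : NeZero n := ⟨by omega⟩
  have hqn : 2 ≤ q * n := by
    rw [div_le_iff₀' hq] at hN
    exact hN.trans (by gcongr; exact le_of_max_le_left hn)
  have hcentred := htwo (uniformOn Set.univ) (Y := fun i => x i k) .of_discrete
    (hvar.trans_eq (sampleVar_apply_self_eq_variance x k))
    ((integral_abs_apply_rpow_le x k (by positivity)).trans hmoment)
  rw [← sampleMean_apply_eq_integral] at hcentred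
  simp_rw [draw_of_lt x _ (show 0 < n by omega), draw_of_lt x _ (show 1 < n by omega)]
  exact hcentred.map_mul_perm hb.le hq.le hqn (Fin.ne_of_val_ne zero_ne_one)

theorem sampleVar_apply_self_le {n m : ℕ} [NeZero n] (x : Fin n → Fin m → ℝ) (k : Fin m) {p : ℝ}
    (hp : 2 ≤ p) : sampleVar x k k ≤ (n : ℝ)⁻¹ * ∑ i, ‖x i‖ ^ p + 1 :=
  calc sampleVar x k k = Var[fun i => x i k; uniformOn Set.univ] :=
        sampleVar_apply_self_eq_variance x k
    _ ≤ ∫ i, x i k ^ 2 ∂(uniformOn Set.univ) := variance_le_expectation_sq .of_discrete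
    _ ≤ ∫ i, |x i k| ^ p ∂(uniformOn Set.univ) + 1 :=
        integral_sq_le_integral_rpow_add_one hp .of_discrete
    _ ≤ (n : ℝ)⁻¹ * ∑ i, ‖x i‖ ^ p + 1 := by
        gcongr
        exact integral_abs_apply_rpow_le x k (by linarith)

theorem measureReal_uStat_sub_le {n m R : ℕ} (hR : 0 < R) {x : Fin n → Fin m → ℝ} {k : Fin m}
    {b B q : ℝ} (hb : 0 < b) (hq : 0 < q)
    (htwo : IsTwoSided ((uniformOn Set.univ).map fun σ =>
      (draw x σ 0 k - sampleMean x k) * (draw x σ 1 k - sampleMean x k)) b B q)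
    (hvar : 0 < sampleVar x k k) {ε : ℝ} (hε : 0 < ε) (c : ℝ) :
    (drawLaw n R).real {π | |uStat x k (sampleMean x k) π - c| ≤ ε}
      ≤ 4 * √m * sampleVar x k k / (q * b) * ε
        + 2 * B ^ 2 / sampleVar x k k ^ 2 * (1 / (R * ε ^ 2)) := by
  have : Nonempty (Fin R) := ⟨⟨0, hR⟩⟩
  have hm : (1 : ℝ) ≤ m := Nat.one_le_cast.mpr k.pos
  have : (0 : ℝ) < R := Nat.cast_pos.mpr hR
  set v := sampleVar x k k
  set s := √((m : ℝ) * R) * v with hs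
  have hs0 : 0 < s := by positivity
  have hscale : {π : Fin R → Equiv.Perm (Fin n) | |uStat x k (sampleMean x k) π - c| ≤ ε}
      = {π | |∑ r, (draw x (π r) 0 k - sampleMean x k) * (draw x (π r) 1 k - sampleMean x k)
          - s * c| ≤ s * ε} := by
    ext π
    have hsum : s * (uStat x k (sampleMean x k) π - c) =
        ∑ r, (draw x (π r) 0 k - sampleMean x k) * (draw x (π r) 1 k - sampleMean x k) - s * c := by
      simp_rw [uStat, mul_right_comm _ (sampleVar x k k)⁻¹, ← Finset.sum_mul, hs]
      simp only [v] at hvar ⊢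
      field_simp
    rw [Set.mem_ofPred_eq, Set.mem_ofPred_eq, ← hsum, abs_mul, abs_of_pos hs0,
      mul_le_mul_iff_right₀ hs0]
  rw [hscale]
  refine (measureReal_pi_abs_sum_sub_le .of_discrete htwo hb hq (by positivity) (s * c)).trans ?_
  have hlinear : 2 * (2 * (s * ε) / (q * b * √(Fintype.card (Fin R))))
      = 4 * √m * v / (q * b) * ε := by
    rw [hs, Fintype.card_fin, Real.sqrt_mul m.cast_nonneg]
    field_simp
    norm_num
  have hsquare : 2 * (B / (s * ε)) ^ 2 ≤ 2 * B ^ 2 / v ^ 2 * (1 / (R * ε ^ 2)) := by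
    rw [hs, div_pow, mul_pow, mul_pow, Real.sq_sqrt (by positivity), mul_one_div, div_div,
      mul_div_assoc']
    gcongr 2 * B ^ 2 / ?_
    nlinarith [mul_le_mul_of_nonneg_right hm (show 0 ≤ R * v ^ 2 * ε ^ 2 by positivity)]
  rw [mul_add, hlinear]
  gcongr

theorem exists_uStat_anticoncentration {m : ℕ} {δ L M : ℝ} (hδ : 0 < δ) (hL : 0 < L) :
    ∃ C > 0, ∃ N : ℕ, ∀ n ≥ N, ∀ R > 0, ∀ (x : Fin n → Fin m → ℝ) (k : Fin m),
      L ≤ sampleVar x k k → (n : ℝ)⁻¹ * ∑ i, ‖x i‖ ^ (2 + δ) ≤ M →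
      ∀ ε > 0, ∀ c : ℝ, (drawLaw n R).real {π | |uStat x k (sampleMean x k) π - c| ≤ ε}
        ≤ C * (ε + 1 / (R * ε ^ 2)) := by
  obtain ⟨b, hb, B, q, hq, N, htwo⟩ := exists_isTwoSided_draw_mul_draw (m := m) (M := M) hδ hL
  set C₁ := 4 * √m * (|M| + 1) / (q * b)
  set C₂ := 2 * B ^ 2 / L ^ 2
  have hC₁ : 0 ≤ C₁ := by positivity
  have hC₂ : 0 ≤ C₂ := by positivity
  refine ⟨C₁ + C₂ + 1, by positivity, max N 1, fun n hn R hR x k hvar hmoment ε hε c => ?_⟩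
  have : NeZero n := ⟨Nat.one_le_iff_ne_zero.mp (le_of_max_le_right hn)⟩
  have hvar_le : sampleVar x k k ≤ |M| + 1 := by
    have := sampleVar_apply_self_le x k (p := 2 + δ) (by linarith)
    linarith [le_abs_self M]
  have hrate : 0 ≤ 1 / (R * ε ^ 2) := by positivity
  calc (drawLaw n R).real {π | |uStat x k (sampleMean x k) π - c| ≤ ε}
      ≤ 4 * √m * sampleVar x k k / (q * b) * ε
        + 2 * B ^ 2 / sampleVar x k k ^ 2 * (1 / (R * ε ^ 2)) :=
        measureReal_uStat_sub_le hR hb hq (htwo n (le_of_max_le_left hn) x k hvar hmoment)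
          (hL.trans_le hvar) hε c
    _ ≤ C₁ * ε + C₂ * (1 / (R * ε ^ 2)) := by
        simp only [C₁, C₂]
        gcongr
    _ ≤ (C₁ + C₂ + 1) * (ε + 1 / (R * ε ^ 2)) := by nlinarith

/-! ### The correction term -/

theorem measureReal_pi_abs_sum_ge_le {S ι : Type*} [MeasurableSpace S] [Fintype ι]
    {μ : Measure S} [IsProbabilityMeasure μ] {w : S → ℝ} (hw : MemLp w 2 μ)
    (hmean : ∫ s, w s ∂μ = 0) {t : ℝ} (ht : 0 < t) :
    (Measure.pi fun _ : ι => μ).real {s | t ≤ |∑ i, w (s i)|}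
      ≤ Fintype.card ι * (∫ s, w s ^ 2 ∂μ) / t ^ 2 := by
  set ν := Measure.pi fun _ : ι => μ
  have hcomp (i : ι) : MemLp (fun s : ι → S => w (s i)) 2 ν :=
    hw.comp_measurePreserving (measurePreserving_eval (fun _ : ι => μ) i)
  have hsum : MemLp (fun s : ι → S => ∑ i, w (s i)) 2 ν := memLp_finsetSum _ fun i _ => hcomp i
  have hzero : ∫ s, ∑ i, w (s i) ∂ν = 0 := by
    rw [integral_finsetSum _ fun i _ => (hcomp i).integrable one_le_two]
    exact Finset.sum_eq_zero fun i _ =>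
      (integral_comp_eval (i := i) hw.aestronglyMeasurable).trans hmean
  have hvar : Var[fun s : ι → S => ∑ i, w (s i); ν] = Fintype.card ι * ∫ s, w s ^ 2 ∂μ := by
    have h := variance_sum_pi (ι := ι) (X := fun _ => w) (fun _ => hw)
    simp only [variance_of_integral_eq_zero hw.aemeasurable hmean, Finset.sum_const,
      Finset.card_univ, nsmul_eq_mul] at h
    rw [← h]
    congr 1 with s
    simp
  have hchebyshev := meas_ge_le_variance_div_sq hsum ht
  rw [hzero, hvar] at hchebyshev
  simp only [sub_zero] at hchebyshev
  exact ENNReal.toReal_le_of_le_ofReal (by positivity) hchebyshev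

theorem integral_perm_apply_add_perm_apply {n : ℕ} (a : Fin n → ℝ) (i j : Fin n) :
    ∫ σ : Equiv.Perm (Fin n), (a (σ i) + a (σ j)) ∂(uniformOn Set.univ)
      = 2 * ∫ l, a l ∂(uniformOn Set.univ) := by
  rw [integral_add .of_finite .of_finite, integral_perm_apply, integral_perm_apply, two_mul]

theorem integral_perm_apply_add_perm_apply_sq_le {n : ℕ} (a : Fin n → ℝ) (i j : Fin n) :
    ∫ σ : Equiv.Perm (Fin n), (a (σ i) + a (σ j)) ^ 2 ∂(uniformOn Set.univ)
      ≤ 4 * ∫ l, a l ^ 2 ∂(uniformOn Set.univ) :=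
  calc ∫ σ : Equiv.Perm (Fin n), (a (σ i) + a (σ j)) ^ 2 ∂(uniformOn Set.univ)
      ≤ ∫ σ : Equiv.Perm (Fin n), 2 * (a (σ i) ^ 2 + a (σ j) ^ 2) ∂(uniformOn Set.univ) :=
        integral_mono .of_finite .of_finite fun σ => add_sq_le
    _ = 4 * ∫ l, a l ^ 2 ∂(uniformOn Set.univ) := by
        rw [integral_const_mul, integral_add .of_finite .of_finite,
          integral_perm_apply (fun l => a l ^ 2), integral_perm_apply (fun l => a l ^ 2)]
        ring

theorem integral_sub_sampleMean {n m : ℕ} [NeZero n] (x : Fin n → Fin m → ℝ) (k : Fin m) :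
    ∫ i, (x i k - sampleMean x k) ∂(uniformOn Set.univ) = 0 := by
  rw [integral_sub .of_finite (integrable_const _), integral_const, probReal_univ, one_smul,
    ← sampleMean_apply_eq_integral, sub_self]

theorem integral_sub_sampleMean_sq {n m : ℕ} (x : Fin n → Fin m → ℝ) (k : Fin m) :
    ∫ i, (x i k - sampleMean x k) ^ 2 ∂(uniformOn Set.univ) = sampleVar x k k := by
  rw [sampleVar_apply_self_eq_variance, variance_eq_integral .of_discrete,
    ← sampleMean_apply_eq_integral]

theorem measureReal_lambdaHat_sub_ge_le {n m R : ℕ} (hn : 2 ≤ n) (hR : 0 < R)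
    (x : Fin n → Fin m → ℝ) (k : Fin m) (hvar : 0 < sampleVar x k k) {t : ℝ} (ht : 0 < t) :
    (drawLaw n R).real {π | t ≤ |lambdaHat x k π
        - √((R : ℝ) / m) * (sampleVar x k k)⁻¹ * sampleMean x k ^ 2|}
      ≤ 4 * sampleMean x k ^ 2 / (sampleVar x k k * t ^ 2) := by
  have : NeZero n := ⟨by omega⟩
  have hm : (1 : ℝ) ≤ m := Nat.one_le_cast.mpr k.pos
  let a : Fin n → ℝ := fun i => x i k - sampleMean x k
  let i₀ : Fin n := ⟨0, by omega⟩
  let i₁ : Fin n := ⟨1, by omega⟩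
  set h := sampleMean x k * (sampleVar x k k)⁻¹ * (1 / √((m : ℝ) * R)) with hh
  have hmean : ∫ σ : Equiv.Perm (Fin n), h * (a (σ i₀) + a (σ i₁)) ∂(uniformOn Set.univ) = 0 := by
    rw [integral_const_mul, integral_perm_apply_add_perm_apply, integral_sub_sampleMean, mul_zero,
      mul_zero]
  have hsecond : ∫ σ : Equiv.Perm (Fin n), (h * (a (σ i₀) + a (σ i₁))) ^ 2 ∂(uniformOn Set.univ)
      ≤ h ^ 2 * (4 * sampleVar x k k) := by
    simp_rw [mul_pow]
    rw [integral_const_mul, ← integral_sub_sampleMean_sq]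
    gcongr
    exact integral_perm_apply_add_perm_apply_sq_le a i₀ i₁
  have hscale : R * (h ^ 2 * (4 * sampleVar x k k)) ≤ 4 * sampleMean x k ^ 2 / sampleVar x k k := by
    rw [hh, mul_pow, mul_pow, div_pow, Real.sq_sqrt (by positivity), le_div_iff₀ hvar]
    field_simp
    exact le_mul_of_one_le_right (by positivity) hm
  simp_rw [lambdaHat_eq_sum_add, add_sub_cancel_right, draw_of_lt x _ (show 0 < n by omega),
    draw_of_lt x _ (show 1 < n by omega)]
  refine (measureReal_pi_abs_sum_ge_le .of_discrete hmean ht).trans ?_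
  rw [Fintype.card_fin, ← div_div]
  gcongr
  exact (mul_le_mul_of_nonneg_left hsecond R.cast_nonneg).trans hscale

theorem measureReal_lambdaHat_gt_le {n m R : ℕ} (hn : 2 ≤ n) (hR : 0 < R)
    (x : Fin n → Fin m → ℝ) (k : Fin m) {L K ε : ℝ} (hL : 0 < L) (hε : 0 < ε)
    (hvar : L ≤ sampleVar x k k) (hmean_nonneg : 0 ≤ sampleMean x k)
    (hmean_le : sampleMean x k ≤ K / √n) (hbias : √R / n * (K ^ 2 / L) ≤ ε / 2) :
    (drawLaw n R).real {π | ε < |lambdaHat x k π|} ≤ 16 * K ^ 2 / (L * ε ^ 2) * (1 / n) := by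
  have hvar_pos : 0 < sampleVar x k k := hL.trans_le hvar
  have hm : (1 : ℝ) ≤ m := Nat.one_le_cast.mpr k.pos
  have hn' : (0 : ℝ) < n := Nat.cast_pos.mpr (by omega)
  have hmean_sq : sampleMean x k ^ 2 ≤ K ^ 2 / n := by
    rw [← Real.sq_sqrt hn'.le, ← div_pow]
    gcongr
  set bias := √((R : ℝ) / m) * (sampleVar x k k)⁻¹ * sampleMean x k ^ 2
  have hbias_nonneg : 0 ≤ bias := by positivity
  have hbias_le : bias ≤ ε / 2 :=
    calc bias ≤ √R * L⁻¹ * (K ^ 2 / n) := by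
          simp only [bias]
          gcongr
          exact div_le_self R.cast_nonneg hm
      _ = √R / n * (K ^ 2 / L) := by ring
      _ ≤ ε / 2 := hbias
  calc (drawLaw n R).real {π | ε < |lambdaHat x k π|}
      ≤ (drawLaw n R).real {π | ε / 2 ≤ |lambdaHat x k π - bias|} := by
        refine measureReal_mono fun π hπ => ?_
        have := abs_sub_abs_le_abs_sub (lambdaHat x k π) bias
        rw [Set.mem_ofPred_eq] at hπ ⊢
        rw [abs_of_nonneg hbias_nonneg] at this
        linarith
    _ ≤ 4 * sampleMean x k ^ 2 / (sampleVar x k k * (ε / 2) ^ 2) :=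
        measureReal_lambdaHat_sub_ge_le hn hR x k hvar_pos (half_pos hε)
    _ ≤ 4 * (K ^ 2 / n) / (L * (ε / 2) ^ 2) := by gcongr
    _ = 16 * K ^ 2 / (L * ε ^ 2) * (1 / n) := by
        field_simp
        ring

/-! ### Quantiles -/

/-- The `p`-quantile of the distribution `ν`; meaningless unless `p ∈ (0, 1)`, where `sInf` could
be taken over an empty or an unbounded set. -/
noncomputable def quantile (ν : Measure ℝ) (p : ℝ) : ℝ :=
  sInf {c | p ≤ cdf ν c}

theorem quantile_le_iff {ν : Measure ℝ} [IsProbabilityMeasure ν] {p : ℝ}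
    (hp : p ∈ Set.Ioo (0 : ℝ) 1) {c : ℝ} : quantile ν p ≤ c ↔ p ≤ cdf ν c := by
  have hne : {c | p ≤ cdf ν c}.Nonempty := ((tendsto_cdf_atTop ν).eventually_const_le hp.2).exists
  have hbdd : BddBelow {c | p ≤ cdf ν c} := by
    obtain ⟨d, hd⟩ := ((tendsto_cdf_atBot ν).eventually_lt_const hp.1).exists
    exact ⟨d, fun c hc => (monotone_cdf ν).reflect_lt (hd.trans_le hc) |>.le⟩
  have hattained : p ≤ cdf ν (quantile ν p) := by
    have hright : Tendsto (cdf ν) (𝓝[>] quantile ν p) (𝓝 (cdf ν (quantile ν p))) :=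
      ((cdf ν).right_continuous _).mono Set.Ioi_subset_Ici_self
    refine ge_of_tendsto hright (eventually_mem_nhdsWithin.mono fun c hc => ?_)
    obtain ⟨d, hd, hdc⟩ := exists_lt_of_csInf_lt hne hc
    exact hd.trans (monotone_cdf ν hdc.le)
  exact ⟨fun h => hattained.trans (monotone_cdf ν h), fun h => csInf_le hbdd h⟩

section Quantile

variable {A : Type*} [MeasurableSpace A] {ρ : Measure A} [IsProbabilityMeasure ρ] {T : A → ℝ}
  {α : ℝ}

theorem measureReal_lt_eq_one_sub_cdf_map (hT : Measurable T) (d : ℝ) :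
    ρ.real {a | d < T a} = 1 - cdf (ρ.map T) d := by
  have : IsProbabilityMeasure (ρ.map T) := Measure.isProbabilityMeasure_map hT.aemeasurable
  rw [cdf_eq_real, ← probReal_compl_eq_one_sub measurableSet_Iic, Set.compl_Iic,
    map_measureReal_apply hT measurableSet_Ioi]
  rfl

theorem measureReal_quantile_lt_le (hT : Measurable T) (hα : α ∈ Set.Ioo (0 : ℝ) 1) :
    ρ.real {a | quantile (ρ.map T) (1 - α) < T a} ≤ α := by
  have : IsProbabilityMeasure (ρ.map T) := Measure.isProbabilityMeasure_map hT.aemeasurable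
  have := (quantile_le_iff (Set.Ioo.one_sub_mem hα)).mp (le_refl (quantile (ρ.map T) (1 - α)))
  rw [measureReal_lt_eq_one_sub_cdf_map hT]
  linarith

theorem le_measureReal_lt_of_lt_quantile (hT : Measurable T) (hα : α ∈ Set.Ioo (0 : ℝ) 1) {d : ℝ}
    (hd : d < quantile (ρ.map T) (1 - α)) : α ≤ ρ.real {a | d < T a} := by
  have : IsProbabilityMeasure (ρ.map T) := Measure.isProbabilityMeasure_map hT.aemeasurable
  have := mt (quantile_le_iff (Set.Ioo.one_sub_mem hα)).mpr hd.not_ge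
  rw [measureReal_lt_eq_one_sub_cdf_map hT]
  linarith

theorem abs_measureReal_quantile_lt_sub_le (hT : Measurable T) (Q : A → ℝ)
    (hα : α ∈ Set.Ioo (0 : ℝ) 1) {ε : ℝ} (hε : 0 < ε) :
    |ρ.real {a | quantile (ρ.map T) (1 - α) < Q a} - α|
      ≤ ρ.real {a | |T a - quantile (ρ.map T) (1 - α)| ≤ ε} + ρ.real {a | ε < |Q a - T a|} := by
  have hle := measureReal_quantile_lt_le (ρ := ρ) hT hα
  have hge := le_measureReal_lt_of_lt_quantile (ρ := ρ) hT hα (sub_lt_self _ hε)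
  set c := quantile (ρ.map T) (1 - α)
  set near := {a | |T a - c| ≤ ε}
  set apart := {a | ε < |Q a - T a|}
  have hsub_of {s t : Set A} (h : s \ t ⊆ near ∪ apart) :
      ρ.real s ≤ ρ.real t + (ρ.real near + ρ.real apart) :=
    calc ρ.real s ≤ ρ.real (t ∪ (near ∪ apart)) := measureReal_mono (Set.sdiff_subset_iff.mp h)
      _ ≤ ρ.real t + ρ.real (near ∪ apart) := measureReal_union_le _ _
      _ ≤ ρ.real t + (ρ.real near + ρ.real apart) := by
          gcongr
          exact measureReal_union_le _ _
  have hupper : ρ.real {a | c < Q a} ≤ ρ.real {a | c < T a} + (ρ.real near + ρ.real apart) := by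
    refine hsub_of fun a ⟨hQ, hT⟩ => or_iff_not_imp_right.mpr fun hQT => ?_
    simp only [apart, near, Set.mem_ofPred_eq, not_lt, abs_le] at hQ hT hQT ⊢
    constructor <;> linarith
  have hlower : ρ.real {a | c - ε < T a}
      ≤ ρ.real {a | c < Q a} + (ρ.real near + ρ.real apart) := by
    refine hsub_of fun a ⟨hT, hQ⟩ => or_iff_not_imp_right.mpr fun hQT => ?_
    simp only [apart, near, Set.mem_ofPred_eq, not_lt, abs_le] at hQ hT hQT ⊢
    constructor <;> linarith
  rw [abs_le]
  constructor <;> linarith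

end Quantile

theorem critVal_eq_quantile {n m : ℕ} (R : ℕ) (α : ℝ) (x : Fin n → Fin m → ℝ) :
    critVal R α x = quantile ((drawLaw n R).map (qTilde x)) (1 - α) := by
  have : IsProbabilityMeasure ((drawLaw n R).map (qTilde x)) :=
    Measure.isProbabilityMeasure_map .of_discrete
  simp_rw [quantile, cdf_eq_real, map_measureReal_apply .of_discrete measurableSet_Iic]
  rfl

/-! ### The conditional rejection probability -/

theorem abs_ciSup_sub_ciSup_le {ι : Type*} [Finite ι] [Nonempty ι] {f g : ι → ℝ} {ε : ℝ}
    (h : ∀ i, |f i - g i| ≤ ε) : |(⨆ i, f i) - ⨆ i, g i| ≤ ε := by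
  have hle {f g : ι → ℝ} (h : ∀ i, |f i - g i| ≤ ε) : ⨆ i, f i ≤ (⨆ i, g i) + ε :=
    ciSup_le fun i => by
      linarith [(abs_le.mp (h i)).2, le_ciSup (Set.finite_range g).bddAbove i]
  exact abs_sub_le_iff.mpr ⟨sub_le_iff_le_add'.mpr (hle h), sub_le_iff_le_add'.mpr
    (hle fun i => (abs_sub_comm _ _).trans_le (h i))⟩

section UnionBounds

variable {n m R : ℕ} [NeZero m] (x : Fin n → Fin m → ℝ)

theorem measureReal_qTilde_sub_le_sum (c ε : ℝ) :
    (drawLaw n R).real {π | |qTilde x π - c| ≤ ε}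
      ≤ ∑ k, (drawLaw n R).real {π | |uStat x k (sampleMean x k) π - c| ≤ ε} := by
  refine (measureReal_mono fun π hπ => ?_).trans (measureReal_iUnion_fintype_le _)
  obtain ⟨k, hk⟩ := exists_eq_ciSup_of_finite (f := fun k => uStat x k (sampleMean x k) π)
  rw [Set.mem_ofPred_eq, qTilde, ← hk] at hπ
  exact Set.mem_iUnion.mpr ⟨k, hπ⟩

theorem measureReal_qStat_sub_qTilde_gt_le_sum {ε : ℝ} (hε : 0 ≤ ε) :
    (drawLaw n R).real {π | ε < |qStat x π - qTilde x π|}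
      ≤ ∑ k, (drawLaw n R).real {π | 0 ≤ sampleMean x k ∧ ε < |lambdaHat x k π|} := by
  refine (measureReal_mono fun π hπ => ?_).trans (measureReal_iUnion_fintype_le _)
  contrapose! hπ
  simp only [Set.mem_iUnion, Set.mem_ofPred_eq, not_exists, not_and, not_lt] at hπ ⊢
  refine abs_ciSup_sub_ciSup_le fun k => ?_
  rw [← uStat_sub_lambdaHat]
  split_ifs with hneg
  · rwa [sub_self, abs_zero]
  · rw [sub_zero, sub_sub_cancel]
    exact hπ k (not_lt.mp hneg)

end UnionBounds

/-- The probability of rejection given the data `x`. -/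
noncomputable def condRejProb {n m : ℕ} (R : ℕ) (α : ℝ) (x : Fin n → Fin m → ℝ) : ℝ :=
  (drawLaw n R).real {π | critVal R α x < qStat x π}

/-- The data sets for which the test has approximately the nominal level: the sample variances are
bounded away from `0`, the empirical moments of order `2 + δ` are bounded, and the sample mean
exceeds `0` by `O(n^{-1/2})` at most. -/
structure IsRegular {n m : ℕ} (δ L M K : ℝ) (x : Fin n → Fin m → ℝ) : Prop where
  le_sampleVar : ∀ k, L ≤ sampleVar x k k
  moment_le : (n : ℝ)⁻¹ * ∑ i, ‖x i‖ ^ (2 + δ) ≤ M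
  sampleMean_le : ∀ k, sampleMean x k ≤ K / √n

section RegularData

variable {m : ℕ} [NeZero m] {R : ℕ → ℕ} {δ L M K : ℝ}

theorem exists_eventually_measureReal_qTilde_sub_le (hR : Tendsto R atTop atTop) (hδ : 0 < δ)
    (hL : 0 < L) {η : ℝ} (hη : 0 < η) :
    ∃ ε > 0, ∀ᶠ n in atTop, ∀ x : Fin n → Fin m → ℝ, IsRegular δ L M K x →
      ∀ c, (drawLaw n (R n)).real {π | |qTilde x π - c| ≤ ε} ≤ η := by
  obtain ⟨C, hC, N, hN⟩ := exists_uStat_anticoncentration (m := m) (M := M) hδ hL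
  have hm : (0 : ℝ) < m := Nat.cast_pos.mpr (NeZero.pos m)
  obtain ⟨ε, hε, hεη⟩ : ∃ ε > 0, m * (C * ε) < η :=
    ⟨η / (2 * (m * C)), by positivity, by field_simp; norm_num⟩
  refine ⟨ε, hε, ?_⟩
  have hrate : Tendsto (fun n => m * (C * (ε + 1 / (R n * ε ^ 2)))) atTop (𝓝 (m * (C * ε))) := by
    have hdiv : Tendsto (fun n => 1 / (R n * ε ^ 2)) atTop (𝓝 0) :=
      ((tendsto_natCast_atTop_atTop.comp hR).atTop_mul_const (by positivity)).const_div_atTop 1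
    simpa only [add_zero] using ((hdiv.const_add ε).const_mul C).const_mul (m : ℝ)
  filter_upwards [eventually_ge_atTop N, hR.eventually_gt_atTop 0, hrate.eventually_le_const hεη]
    with n hn hRn hle x hx c
  calc (drawLaw n (R n)).real {π | |qTilde x π - c| ≤ ε}
      ≤ ∑ k, (drawLaw n (R n)).real {π | |uStat x k (sampleMean x k) π - c| ≤ ε} :=
        measureReal_qTilde_sub_le_sum x c ε
    _ ≤ ∑ _k : Fin m, C * (ε + 1 / (R n * ε ^ 2)) := Finset.sum_le_sum fun k _ =>
        hN n hn (R n) hRn x k (hx.le_sampleVar k) hx.moment_le ε hε c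
    _ = m * (C * (ε + 1 / (R n * ε ^ 2))) := by
        rw [Finset.sum_const, Finset.card_univ, Fintype.card_fin, nsmul_eq_mul]
    _ ≤ η := hle

theorem eventually_measureReal_qStat_sub_qTilde_gt_le (hR : Tendsto R atTop atTop)
    (hRn : Tendsto (fun n : ℕ => √(R n : ℝ) / n) atTop (𝓝 0)) (hL : 0 < L) {ε η : ℝ} (hε : 0 < ε)
    (hη : 0 < η) :
    ∀ᶠ n in atTop, ∀ x : Fin n → Fin m → ℝ, IsRegular δ L M K x →
      (drawLaw n (R n)).real {π | ε < |qStat x π - qTilde x π|} ≤ η := by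
  have hbias : Tendsto (fun n : ℕ => √(R n : ℝ) / n * (K ^ 2 / L)) atTop (𝓝 0) := by
    simpa only [zero_mul] using hRn.mul_const (K ^ 2 / L)
  have hrate : Tendsto (fun n : ℕ => m * (16 * K ^ 2 / (L * ε ^ 2) * (1 / (n : ℝ)))) atTop
      (𝓝 0) := by
    simpa only [mul_zero] using
      (tendsto_one_div_atTop_nhds_zero_nat.const_mul (16 * K ^ 2 / (L * ε ^ 2))).const_mul (m : ℝ)
  filter_upwards [eventually_ge_atTop 2, hR.eventually_gt_atTop 0,
    hbias.eventually_le_const (half_pos hε), hrate.eventually_le_const hη]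
    with n hn hRpos hbias_le hle x hx
  calc (drawLaw n (R n)).real {π | ε < |qStat x π - qTilde x π|}
      ≤ ∑ k, (drawLaw n (R n)).real {π | 0 ≤ sampleMean x k ∧ ε < |lambdaHat x k π|} :=
        measureReal_qStat_sub_qTilde_gt_le_sum x hε.le
    _ ≤ ∑ _k : Fin m, 16 * K ^ 2 / (L * ε ^ 2) * (1 / n) := by
        refine Finset.sum_le_sum fun k _ => ?_
        by_cases hk : 0 ≤ sampleMean x k
        · simp only [hk, true_and]
          exact measureReal_lambdaHat_gt_le hn hRpos x k hL hε (hx.le_sampleVar k) hk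
            (hx.sampleMean_le k) hbias_le
        · simp only [hk, false_and, Set.ofPred_false, measureReal_empty]
          positivity
    _ = m * (16 * K ^ 2 / (L * ε ^ 2) * (1 / n)) := by
        rw [Finset.sum_const, Finset.card_univ, Fintype.card_fin, nsmul_eq_mul]
    _ ≤ η := hle

theorem eventually_abs_condRejProb_sub_le {α : ℝ} (hα : α ∈ Set.Ioo (0 : ℝ) 1)
    (hR : Tendsto R atTop atTop) (hRn : Tendsto (fun n : ℕ => √(R n : ℝ) / n) atTop (𝓝 0))
    (hδ : 0 < δ) (hL : 0 < L) {η : ℝ} (hη : 0 < η) :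
    ∀ᶠ n in atTop, ∀ x : Fin n → Fin m → ℝ, IsRegular δ L M K x →
      |condRejProb (R n) α x - α| ≤ η := by
  obtain ⟨ε, hε, hconc⟩ :=
    exists_eventually_measureReal_qTilde_sub_le (m := m) (M := M) (K := K) hR hδ hL (half_pos hη)
  filter_upwards [hconc, eventually_measureReal_qStat_sub_qTilde_gt_le (m := m) hR hRn hL hε
    (half_pos hη)] with n hnear hapart x hx
  calc |condRejProb (R n) α x - α|
      ≤ (drawLaw n (R n)).real {π | |qTilde x π - critVal (R n) α x| ≤ ε}
        + (drawLaw n (R n)).real {π | ε < |qStat x π - qTilde x π|} := by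
        rw [condRejProb, critVal_eq_quantile]
        exact abs_measureReal_quantile_lt_sub_le .of_discrete (qStat x) hα hε
    _ ≤ η / 2 + η / 2 := add_le_add (hnear x hx _) (hapart x hx)
    _ = η := add_halves η

end RegularData

/-! ### Measurability -/

section Measurability

variable {n m R : ℕ}

theorem measurable_sampleMean : Measurable (sampleMean : (Fin n → Fin m → ℝ) → Fin m → ℝ) := by
  unfold sampleMean
  fun_prop

theorem measurable_sampleVar_apply_self (k : Fin m) :
    Measurable fun x : Fin n → Fin m → ℝ => sampleVar x k k := by
  have := measurable_sampleMean (n := n) (m := m)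
  simp only [sampleVar, Matrix.smul_apply, Matrix.sum_apply, Matrix.vecMulVec_apply, Pi.sub_apply]
  fun_prop

theorem measurable_uStat (k : Fin m) {μ : (Fin n → Fin m → ℝ) → ℝ} (hμ : Measurable μ)
    (π : Fin R → Equiv.Perm (Fin n)) :
    Measurable fun x : Fin n → Fin m → ℝ => uStat x k (μ x) π := by
  have hdraw (σ : Equiv.Perm (Fin n)) (j : ℕ) :
      Measurable fun x : Fin n → Fin m → ℝ => draw x σ j k := by
    unfold draw obs
    split_ifs <;> fun_prop
  have hvar := measurable_sampleVar_apply_self (n := n) k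
  unfold uStat
  fun_prop

theorem measurable_uStat_sampleMean (k : Fin m) (π : Fin R → Equiv.Perm (Fin n)) :
    Measurable fun x : Fin n → Fin m → ℝ => uStat x k (sampleMean x k) π :=
  measurable_uStat k ((measurable_pi_apply k).comp measurable_sampleMean) π

theorem measurable_lambdaHat (k : Fin m) (π : Fin R → Equiv.Perm (Fin n)) :
    Measurable fun x : Fin n → Fin m → ℝ => lambdaHat x k π := by
  have h : Measurable fun x : Fin n → Fin m → ℝ => uStat x k 0 π - uStat x k (sampleMean x k) π :=
    (measurable_uStat k measurable_const π).sub (measurable_uStat_sampleMean k π)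
  simpa only [← uStat_sub_lambdaHat, sub_sub_cancel] using h

theorem measurable_qTilde :
    Measurable fun p : (Fin n → Fin m → ℝ) × (Fin R → Equiv.Perm (Fin n)) => qTilde p.1 p.2 :=
  measurable_from_prod_countable_left fun π =>
    Measurable.iSup fun k => measurable_uStat_sampleMean k π

theorem measurable_qStat :
    Measurable fun p : (Fin n → Fin m → ℝ) × (Fin R → Equiv.Perm (Fin n)) => qStat p.1 p.2 :=
  measurable_from_prod_countable_left fun π =>
    Measurable.iSup fun k => (measurable_uStat k measurable_const π).sub <|
      Measurable.ite
        (measurableSet_lt ((measurable_pi_apply k).comp measurable_sampleMean) measurable_const)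
        (measurable_lambdaHat k π) measurable_const

theorem measurable_critVal (R : ℕ) {α : ℝ} (hα : α ∈ Set.Ioo (0 : ℝ) 1) :
    Measurable fun x : Fin n → Fin m → ℝ => critVal R α x := by
  refine measurable_of_Iic fun c => ?_
  have hpreimage : (fun x : Fin n → Fin m → ℝ => critVal R α x) ⁻¹' Set.Iic c
      = {x | 1 - α ≤ (drawLaw n R).real {π | qTilde x π ≤ c}} := by
    ext x
    have : IsProbabilityMeasure ((drawLaw n R).map (qTilde x)) :=
      Measure.isProbabilityMeasure_map .of_discrete
    rw [Set.mem_preimage, Set.mem_Iic, critVal_eq_quantile,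
      quantile_le_iff (Set.Ioo.one_sub_mem hα), cdf_eq_real,
      map_measureReal_apply .of_discrete measurableSet_Iic]
    rfl
  rw [hpreimage]
  exact measurableSet_le measurable_const (measurable_measure_prodMk_left
    (measurableSet_le measurable_qTilde measurable_const)).ennreal_toReal

theorem measurableSet_critVal_lt_qStat {α : ℝ} (hα : α ∈ Set.Ioo (0 : ℝ) 1) :
    MeasurableSet {p : (Fin n → Fin m → ℝ) × (Fin R → Equiv.Perm (Fin n)) |
      critVal R α p.1 < qStat p.1 p.2} :=
  measurableSet_lt ((measurable_critVal R hα).comp measurable_fst) measurable_qStat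

theorem measurable_condRejProb {α : ℝ} (hα : α ∈ Set.Ioo (0 : ℝ) 1) :
    Measurable fun x : Fin n → Fin m → ℝ => condRejProb R α x :=
  (measurable_measure_prodMk_left (measurableSet_critVal_lt_qStat hα)).ennreal_toReal

end Measurability

/-! ### The rejection probability -/

theorem integral_prod_indicator_one {A B : Type*} [MeasurableSpace A] [MeasurableSpace B]
    {μ : Measure A} {ν : Measure B} [IsFiniteMeasure μ] [IsFiniteMeasure ν] {s : Set (A × B)}
    (hs : MeasurableSet s) :
    ∫ z, s.indicator (1 : A × B → ℝ) z ∂(μ.prod ν) = ∫ a, ν.real (Prod.mk a ⁻¹' s) ∂μ := by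
  have hint : Integrable (s.indicator (1 : A × B → ℝ)) (μ.prod ν) :=
    (integrable_const (1 : ℝ)).indicator hs
  rw [integral_prod _ hint]
  exact integral_congr_ae (ae_of_all _ fun a =>
    integral_indicator_one (measurable_prodMk_left hs))

section Array

variable {Ω : Type*} [MeasurableSpace Ω] {m : ℕ} {X : (n : ℕ) → Fin n → Ω → Fin m → ℝ}

theorem measurable_sample (hX : ∀ n i, Measurable (X n i)) (n : ℕ) : Measurable (sample X n) :=
  measurable_pi_lambda _ fun i => hX n i

theorem rejProb_eq_integral_condRejProb (hX : ∀ n i, Measurable (X n i)) {α : ℝ}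
    (hα : α ∈ Set.Ioo (0 : ℝ) 1) (n R : ℕ) (P : ProbabilityMeasure Ω) :
    rejProb X α n R P = ∫ ω, condRejProb R α (sample X n ω) ∂(P : Measure Ω) := by
  have hset : MeasurableSet {z : Ω × (Fin R → Equiv.Perm (Fin n)) |
      critVal R α (sample X n z.1) < qStat (sample X n z.1) z.2} :=
    ((measurable_sample hX n).prodMap measurable_id) (measurableSet_critVal_lt_qStat hα)
  have htest : (fun z : Ω × (Fin R → Equiv.Perm (Fin n)) => testFn α (sample X n z.1) z.2)
      = {z | critVal R α (sample X n z.1) < qStat (sample X n z.1) z.2}.indicator 1 := by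
    ext z
    simp only [testFn, Set.indicator_apply, Set.mem_ofPred_eq, Pi.one_apply]
  rw [rejProb, htest, integral_prod_indicator_one hset]
  rfl

end Array

theorem abs_integral_sub_le_add_measureReal {Ω : Type*} [MeasurableSpace Ω] {P : Measure Ω}
    [IsProbabilityMeasure P] {f : Ω → ℝ} (hf : Measurable f) (hf01 : ∀ ω, f ω ∈ Set.Icc (0 : ℝ) 1)
    {a : ℝ} (ha : a ∈ Set.Icc (0 : ℝ) 1) {η : ℝ} (hη : 0 ≤ η) :
    |∫ ω, f ω ∂P - a| ≤ η + P.real {ω | η < |f ω - a|} := by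
  have hfi : Integrable f P := .of_mem_Icc 0 1 hf.aemeasurable (ae_of_all _ hf01)
  have hset : MeasurableSet {ω | η < |f ω - a|} := measurableSet_lt measurable_const (by fun_prop)
  have hind : Integrable ({ω | η < |f ω - a|}.indicator (1 : Ω → ℝ)) P :=
    (integrable_const (1 : ℝ)).indicator hset
  have hpoint (ω : Ω) : |f ω - a| ≤ η + {ω | η < |f ω - a|}.indicator (1 : Ω → ℝ) ω := by
    by_cases hω : η < |f ω - a|
    · rw [Set.indicator_of_mem (by exact hω), Pi.one_apply]
      linarith [Real.dist_le_of_mem_Icc_01 (hf01 ω) ha, Real.dist_eq (f ω) a]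
    · rw [Set.indicator_of_notMem (by exact hω), add_zero]
      exact not_lt.mp hω
  calc |∫ ω, f ω ∂P - a| = |∫ ω, (f ω - a) ∂P| := by
        rw [integral_sub hfi (integrable_const a), integral_const, probReal_univ, one_smul]
    _ ≤ ∫ ω, |f ω - a| ∂P := abs_integral_le_integral_abs
    _ ≤ ∫ ω, (η + {ω | η < |f ω - a|}.indicator (1 : Ω → ℝ) ω) ∂P :=
        integral_mono (hfi.sub (integrable_const a)).abs ((integrable_const η).add hind) hpoint
    _ = η + P.real {ω | η < |f ω - a|} := by
        rw [integral_add (integrable_const η) hind, integral_indicator_one hset, integral_const,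
          probReal_univ, one_smul]

/-! ### Null sequences and null classes -/

theorem abs_apply_le_maxNorm {m : ℕ} (S : Matrix (Fin m) (Fin m) ℝ) (i j : Fin m) :
    |S i j| ≤ maxNorm S :=
  (le_ciSup (f := fun j => |S i j|) (Set.finite_range _).bddAbove j).trans
    (le_ciSup (f := fun i => ⨆ j, |S i j|) (Set.finite_range _).bddAbove i)

theorem le_apply_self_of_le_eigenvalues {ι : Type*} [Fintype ι] [DecidableEq ι]
    {S : Matrix ι ι ℝ} (hS : S.IsHermitian) {L : ℝ} (hL : ∀ k, L ≤ hS.eigenvalues k) (k : ι) :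
    L ≤ S k k := by
  have hpos : (S - algebraMap ℝ (Matrix ι ι ℝ) L).PosSemidef := by
    refine Matrix.posSemidef_iff_isHermitian_and_spectrum_nonneg.mpr
      ⟨hS.sub (Matrix.isHermitian_diagonal _), ?_⟩
    rw [← spectrum.sub_singleton_eq, hS.spectrum_real_eq_range_eigenvalues]
    rintro _ ⟨_, ⟨i, rfl⟩, _, rfl, rfl⟩
    exact sub_nonneg.mpr (hL i)
  have := hpos.diag_nonneg (i := k)
  rwa [Matrix.sub_apply, Matrix.algebraMap_matrix_apply, if_pos rfl, sub_nonneg] at this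

theorem norm_sqrt_smul_posPart_sampleMean_le {n m : ℕ} (x : Fin n → Fin m → ℝ) {μ : Fin m → ℝ}
    (hμ : μ ≤ 0) : ‖√(n : ℝ) • (sampleMean x)⁺‖ ≤ ‖(√(n : ℝ))⁻¹ • ∑ i, (x i - μ)‖ := by
  have hcentre : (√(n : ℝ))⁻¹ • ∑ i, (x i - μ) = √(n : ℝ) • (sampleMean x - μ) := by
    rcases n.eq_zero_or_pos with rfl | _
    · simp
    · rw [Finset.sum_sub_distrib, Finset.sum_const, Finset.card_univ, Fintype.card_fin,
        ← Nat.cast_smul_eq_nsmul ℝ, sampleMean, smul_sub, smul_sub, smul_smul, smul_smul,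
        ← div_eq_mul_inv, ← div_eq_inv_mul, Real.sqrt_div_self, Real.div_sqrt]
  rw [hcentre, norm_smul, norm_smul]
  gcongr
  refine (pi_norm_le_iff_of_nonneg (norm_nonneg _)).mpr fun k => ?_
  refine le_trans ?_ (norm_le_pi_norm (sampleMean x - μ) k)
  calc ‖(sampleMean x k)⁺‖ = (sampleMean x k)⁺ := Real.norm_of_nonneg (posPart_nonneg _)
    _ ≤ ‖sampleMean x k - μ k‖ :=
        sup_le (((le_sub_self_iff _).mpr (hμ k)).trans (le_abs_self _)) (norm_nonneg _)

theorem IsRegular.of_norm_le {n m : ℕ} (hn : 0 < n) {x : Fin n → Fin m → ℝ} {δ L M K : ℝ}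
    (hvar : ∀ k, L ≤ sampleVar x k k) (hmoment : ‖(n : ℝ)⁻¹ * ∑ i, ‖x i‖ ^ (2 + δ)‖ ≤ M)
    (hmean : ‖√(n : ℝ) • (sampleMean x)⁺‖ ≤ K) : IsRegular δ L M K x where
  le_sampleVar := hvar
  moment_le := (le_abs_self _).trans hmoment
  sampleMean_le k := by
    rw [le_div_iff₀' (by positivity)]
    calc √n * sampleMean x k ≤ √n * (sampleMean x)⁺ k := by
          gcongr
          exact le_posPart (sampleMean x) k
      _ ≤ ‖√(n : ℝ) • (sampleMean x)⁺‖ :=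
          (le_abs_self _).trans (norm_le_pi_norm (√(n : ℝ) • (sampleMean x)⁺) k)
      _ ≤ K := hmean

section NullSequence

variable {Ω : Type*} [MeasurableSpace Ω] {m : ℕ} {X : (n : ℕ) → Fin n → Ω → Fin m → ℝ}
  {P : ℕ → ProbabilityMeasure Ω}

/-- A sequence of data-generating processes that satisfies the null hypothesis asymptotically: the
sample mean exceeds `0` by at most `O_P(n^{-1/2})`, and the data are otherwise well behaved with
probability close to one. -/
structure IsNullSequence (X : (n : ℕ) → Fin n → Ω → Fin m → ℝ) (P : ℕ → ProbabilityMeasure Ω) :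
    Prop where
  sampleMean_posPart : IsBoundedInProb P fun n ω => √(n : ℝ) • (sampleMean (sample X n ω))⁺
  sampleVar_pos : ∀ ε > (0 : ℝ), ∃ L > (0 : ℝ), ∀ᶠ n in atTop,
    (P n : Measure Ω).real {ω | ∃ k, sampleVar (sample X n ω) k k < L} ≤ ε
  moment : ∃ δ > (0 : ℝ),
    IsBoundedInProb P fun n ω => (n : ℝ)⁻¹ * ∑ i, ‖X n i ω‖ ^ (2 + δ)

theorem IsBoundedInProb.mono {E F : Type*} [Norm E] [Norm F] {Y : ℕ → Ω → E} {Z : ℕ → Ω → F}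
    (hZ : IsBoundedInProb P Z) (h : ∀ n ω, ‖Y n ω‖ ≤ ‖Z n ω‖) : IsBoundedInProb P Y :=
  fun ε hε => (hZ ε hε).imp fun _M hM => hM.mono fun n hn =>
    (measureReal_mono fun ω (hω : _ < _) => hω.trans_le (h n ω)).trans hn

theorem measureReal_sampleVar_lt_le {n : ℕ} {Q : ProbabilityMeasure Ω}
    {S : Matrix (Fin m) (Fin m) ℝ} (hS : S.IsHermitian) {L : ℝ} (hL : ∀ k, L ≤ hS.eigenvalues k) :
    (Q : Measure Ω).real {ω | ∃ k, sampleVar (sample X n ω) k k < L / 2}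
      ≤ (Q : Measure Ω).real {ω | L / 2 ≤ maxNorm (sampleVar (sample X n ω) - S)} := by
  refine measureReal_mono fun ω ⟨k, hk⟩ => ?_
  have hdiag := le_apply_self_of_le_eigenvalues hS hL k
  have hdiff := (neg_abs_le _).trans' (neg_le_neg (abs_apply_le_maxNorm
    (sampleVar (sample X n ω) - S) k k))
  rw [Matrix.sub_apply] at hdiff
  rw [Set.mem_ofPred_eq]
  linarith

theorem IsNullClass.isNullSequence {P₀ : Set (ProbabilityMeasure Ω)} (hP₀ : IsNullClass X P₀)
    (hP : ∀ n, P n ∈ P₀) : IsNullSequence X P := by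
  obtain ⟨-, δ, L, _, hδ, hL, -, hseq⟩ := hP₀
  obtain ⟨hmean, ⟨S, hS, hvar⟩, hmoment, hnull⟩ := hseq P hP
  refine ⟨hmean.mono fun n ω => norm_sqrt_smul_posPart_sampleMean_le _ (hnull n),
    fun ε hε => ⟨L / 2, half_pos hL, ?_⟩, δ, hδ, hmoment⟩
  filter_upwards [(hvar _ (half_pos hL)).eventually_le_const hε] with n hn
  obtain ⟨-, hherm, heig⟩ := hS n
  exact (measureReal_sampleVar_lt_le hherm fun k => (heig k).le).trans hn

theorem IsNullSequence.exists_eventually_measureReal_not_isRegular_le (h : IsNullSequence X P)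
    {η : ℝ} (hη : 0 < η) : ∃ δ > 0, ∃ L > 0, ∃ M K, ∀ᶠ n in atTop,
      (P n : Measure Ω).real {ω | ¬IsRegular δ L M K (sample X n ω)} ≤ η := by
  obtain ⟨δ, hδ, hmoment⟩ := h.moment
  obtain ⟨L, hL, hvar⟩ := h.sampleVar_pos (η / 3) (by positivity)
  obtain ⟨M, hM⟩ := hmoment (η / 3) (by positivity)
  obtain ⟨K, hK⟩ := h.sampleMean_posPart (η / 3) (by positivity)
  refine ⟨δ, hδ, L, hL, M, K, ?_⟩
  filter_upwards [hvar, hM, hK, eventually_gt_atTop 0] with n hvar_le hM_le hK_le hn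
  have hsub : {ω | ¬IsRegular δ L M K (sample X n ω)}
      ⊆ {ω | ∃ k, sampleVar (sample X n ω) k k < L}
        ∪ ({ω | M < ‖(n : ℝ)⁻¹ * ∑ i, ‖X n i ω‖ ^ (2 + δ)‖}
          ∪ {ω | K < ‖√(n : ℝ) • (sampleMean (sample X n ω))⁺‖}) := by
    intro ω hω
    contrapose! hω
    simp only [Set.mem_union, Set.mem_ofPred_eq, not_or, not_exists, not_lt, not_not] at hω ⊢
    exact IsRegular.of_norm_le hn hω.1 hω.2.1 hω.2.2
  calc (P n : Measure Ω).real {ω | ¬IsRegular δ L M K (sample X n ω)}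
      ≤ η / 3 + (η / 3 + η / 3) := (measureReal_mono hsub).trans <|
        (measureReal_union_le _ _).trans <| add_le_add hvar_le <|
          (measureReal_union_le _ _).trans <| add_le_add hM_le hK_le
    _ = η := by ring

theorem IsNullSequence.tendsto_rejProb [NeZero m] (h : IsNullSequence X P)
    (hX : ∀ n i, Measurable (X n i)) {α : ℝ} (hα : α ∈ Set.Ioo (0 : ℝ) 1) {R : ℕ → ℕ}
    (hR : Tendsto R atTop atTop) (hRn : Tendsto (fun n : ℕ => √(R n : ℝ) / n) atTop (𝓝 0)) :
    Tendsto (fun n => rejProb X α n (R n) (P n)) atTop (𝓝 α) := by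
  refine Metric.tendsto_nhds.mpr fun ε hε => ?_
  have hη : 0 < ε / 3 := by positivity
  obtain ⟨δ, hδ, L, hL, M, K, hirregular⟩ :=
    h.exists_eventually_measureReal_not_isRegular_le hη
  filter_upwards [hirregular, eventually_abs_condRejProb_sub_le (m := m) (M := M) (K := K) hα hR
    hRn hδ hL hη] with n hirr hreg
  calc dist (rejProb X α n (R n) (P n)) α
      = |∫ ω, condRejProb (R n) α (sample X n ω) ∂(P n : Measure Ω) - α| := by
        rw [Real.dist_eq, rejProb_eq_integral_condRejProb hX hα]
    _ ≤ ε / 3 + (P n : Measure Ω).real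
          {ω | ε / 3 < |condRejProb (R n) α (sample X n ω) - α|} :=
        abs_integral_sub_le_add_measureReal
          ((measurable_condRejProb hα).comp (measurable_sample hX n))
          (fun ω => ⟨measureReal_nonneg, measureReal_le_one⟩) (Set.Ioo_subset_Icc_self hα) hη.le
    _ ≤ ε / 3 + (P n : Measure Ω).real {ω | ¬IsRegular δ L M K (sample X n ω)} := by
        gcongr ε / 3 + ?_
        exact measureReal_mono fun ω hω hregular => (hreg _ hregular).not_gt hω
    _ ≤ ε / 3 + ε / 3 := by gcongr
    _ < ε := by linarith

end NullSequence

theorem tendsto_ciSup_of_forall_seq {ι : Type*} [Nonempty ι] {f : ℕ → ι → ℝ} {a : ℝ}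
    (h : ∀ u : ℕ → ι, Tendsto (fun n => f n (u n)) atTop (𝓝 a)) :
    Tendsto (fun n => ⨆ i, f n i) atTop (𝓝 a) := by
  refine Metric.tendsto_nhds.mpr fun ε hε => ?_
  -- `u` violates the bound at every `n` at which some index does.
  let u (n : ℕ) : ι := Classical.epsilon fun i => ε / 2 < |f n i - a|
  filter_upwards [Metric.tendsto_nhds.mp (h u) (ε / 2) (half_pos hε)] with n hn
  have hall (i : ι) : |f n i - a| ≤ ε / 2 := by
    by_contra! hi
    have hworst : ε / 2 < |f n (u n) - a| :=
      Classical.epsilon_spec (p := fun i => ε / 2 < |f n i - a|) ⟨i, hi⟩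
    exact hworst.not_gt hn
  have hbdd : BddAbove (Set.range (f n)) :=
    ⟨a + ε / 2, Set.forall_mem_range.mpr fun i => by linarith [(abs_le.mp (hall i)).2]⟩
  have hupper : ⨆ i, f n i ≤ a + ε / 2 := ciSup_le fun i => by linarith [(abs_le.mp (hall i)).2]
  have hlower : a - ε / 2 ≤ ⨆ i, f n i :=
    le_ciSup_of_le hbdd (u n) (by linarith [(abs_le.mp (hall (u n))).1])
  rw [Real.dist_eq, abs_lt]
  constructor <;> linarith

end ResampledMI

theorem theorem2_general {Ω : Type*} [MeasurableSpace Ω] {m : ℕ} (hm : 0 < m)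
    (X : (n : ℕ) → Fin n → Ω → Fin m → ℝ) (hX : ∀ n i, Measurable (X n i))
    (P₀ : Set (ProbabilityMeasure Ω)) (hne : P₀.Nonempty)
    (hP₀ : ∀ P : ℕ → ProbabilityMeasure Ω, (∀ n, P n ∈ P₀) → ResampledMI.IsNullSequence X P)
    (α : ℝ) (hα : α ∈ Set.Ioo (0 : ℝ) 1)
    (R : ℕ → ℕ) (hR : Tendsto R atTop atTop)
    (hRn : Tendsto (fun n : ℕ => √(R n : ℝ) / n) atTop (𝓝 0)) :
    Tendsto (fun n => ⨆ P : P₀, ResampledMI.rejProb X α n (R n) P) atTop (𝓝 α) := by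
  have : NeZero m := ⟨hm.ne'⟩
  have : Nonempty P₀ := hne.to_subtype
  exact ResampledMI.tendsto_ciSup_of_forall_seq fun P =>
    (hP₀ (fun n => P n) fun n => (P n).2).tendsto_rejProb hX hα hR hRn

theorem theorem2 {Ω : Type*} [MeasurableSpace Ω] {m : ℕ} (hm : 0 < m)
    (X : (n : ℕ) → Fin n → Ω → Fin m → ℝ) (hX : ∀ n i, Measurable (X n i))
    (P₀ : Set (ProbabilityMeasure Ω)) (hne : P₀.Nonempty) (hP₀ : ResampledMI.IsNullClass X P₀)
    (α : ℝ) (hα : α ∈ Set.Ioo (0 : ℝ) 1)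
    (R : ℕ → ℕ) (hR : Tendsto R atTop atTop)
    (hRn : Tendsto (fun n : ℕ => √(R n : ℝ) / n) atTop (𝓝 0)) :
    Tendsto (fun n => ⨆ P : P₀, ResampledMI.rejProb X α n (R n) P) atTop (𝓝 α) :=
  theorem2_general hm X hX P₀ hne (fun _ hP => hP₀.isNullSequence hP) α hα R hR hRn
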